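/- **Setting.** Let $d\ge 1$, $L>0$, $N\ge 2$ even, and let $\mathcal F^N$ be the $N$-particle sector of the bosonic Fock space over $L^2$ of the $d$-dimensional periodic box of side $L$, with annihilation operators $a_{\mathbf j}$ of the plane-wave modes $\mathbf j\in\mathbb Z^d$, $k_{\mathbf j}=\frac{2\pi}{L}\mathbf j$, and $\Delta_0=\min_{\mathbf j\ne 0}k_{\mathbf j}^2$. Fix a mode $\mathbf j_*\neq 0$ and a Fourier component $\phi=\phi_{\mathbf j_*}>0$ of the pair potential, and put $k^2=k_{\mathbf j_*}^2$, $\epsilon=k^2/\phi$, $E^{Bog}=-[k^2+\phi-\sqrt{k^4+2\phi k^2}]$, $$W=\frac{\phi}{N}a_0^*a_0^*a_{\mathbf j_*}a_{-\mathbf j_*},\qquad H=\sum_{\mathbf j\ne\pm\mathbf j_*}k_{\mathbf j}^2a_{\mathbf j}^*a_{\mathbf j}+\Big(k^2+\frac{\phi}{N}a_0^*a_0\Big)(a_{\mathbf j_*}^*a_{\mathbf j_*}+a_{-\mathbf j_*}^*a_{-\mathbf j_*})+W+W^*$$ on $\mathcal F^N$. For even $0\le i\le N-2$ let $Q_i$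 be the orthogonal projection onto the states with $N-i$ or $N-i-1$ particles in the modes $\pm\mathbf j_*$, and for real $z$ put $R_{i}(z)=Q_i\,\frac{1}{Q_i(H-z)Q_i}\,Q_i$ (inverse taken on $Q_i\mathcal F^N$), $W_{i,i-2}=Q_iWQ_{i-2}$, $W^*_{i-2,i}=Q_{i-2}W^*Q_i$. Define recursively $$\Gamma_2(z)=W_{2,0}R_0(z)W^*_{0,2},\qquad \Gamma_i(z)=W_{i,i-2}R_{i-2}(z)\sum_{l=0}^\infty[\Gamma_{i-2}(z)R_{i-2}(z)]^l\,W^*_{i-2,i}\quad(i\ge4),$$ $$\check\Gamma_0(z)=1,\qquad \check\Gamma_i(z)=\sum_{l=0}^\infty\big[R_i(z)^{1/2}\,\Gamma_i(z)\,R_i(z)^{1/2}\big]^l\quad(i\ge 2),$$ $$A(z)=W\,R_{N-2}(z)^{1/2}\,\check\Gamma_{N-2}(z)\,R_{N-2}(z)^{1/2}\,W^*.$$ Let $\eta$ be the normalized state with all $N$ particles in the zero mode, $P_\eta=|\eta\rangle\langle\eta|$, and $\overline{P_\eta}=Q^{(0)}-P_\eta$, where $Q^{(0)}$ is the orthogonal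 projection onto the states without particles in the modes $\pm\mathbf j_*$. **Statement.** Let $\nu>\frac{11}{8}$, $0<\mu<1$, $\theta>0$, $K>0$. There are $\epsilon_0,C,c>0$, depending only on $\nu,\mu,\theta,K$, such that whenever $$\epsilon\le\epsilon_0,\qquad \frac1N\le\epsilon^\nu,\qquad \frac{\phi}{\Delta_0}\,\frac{N^\mu}{N(N-N^\mu)}<\frac12,\qquad \frac1{N^\mu}\le K(\sqrt\epsilon)^{1+\theta},$$ the following holds for every real $z<E^{Bog}+\sqrt\epsilon\,\phi\sqrt{\epsilon^2+2\epsilon}$. At both spectral parameters $z$ and $z-\frac{\Delta_0}2$ all objects above are well defined (the $R_i$ exist as bounded positive operators and all the series converge in operator norm), and $$\big\|\overline{P_\eta}\,A(z)\,\overline{P_\eta}\big\|\;\le\;\big\|P_\eta\,A\big(z-\tfrac{\Delta_0}{2}\big)\,P_\eta\big\|+\frac{C}{\sqrt\epsilon}\Big(\frac{1}{1+c\sqrt\epsilon}\Big)^{N^\mu}.$$ -/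

import Mathlib

open scoped ENNReal InnerProductSpace

noncomputable section

namespace Bog

/-! ### Fock space sectors in the occupation number representation -/

/-- Modes: the mode `j : Mode d` stands for the plane wave of wave vector `(2π/L) j`. -/
abbrev Mode (d : ℕ) := Fin d → ℤ

/-- Occupation numbers of the modes, with total particle number `n`. -/
abbrev Occ (d n : ℕ) := {c : Mode d →₀ ℕ // c.degree = n}

/-- The `n`-particle sector of the bosonic Fock space over `L²` of the periodic box: its
orthonormal basis of normalized product states of plane waves is indexed by `Occ d n`. -/
def Sector (d n : ℕ) : Type := lp (fun _ : Occ d n => ℂ) 2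

instance (d n : ℕ) : NormedAddCommGroup (Sector d n) :=
  inferInstanceAs (NormedAddCommGroup (lp (fun _ : Occ d n => ℂ) 2))

instance (d n : ℕ) : InnerProductSpace ℂ (Sector d n) :=
  inferInstanceAs (InnerProductSpace ℂ (lp (fun _ : Occ d n => ℂ) 2))

instance (d n : ℕ) : CompleteSpace (Sector d n) :=
  inferInstanceAs (CompleteSpace (lp (fun _ : Occ d n => ℂ) 2))

/-- A vector of the sector as a square summable family of coefficients. -/
def Sector.toLp {d n : ℕ} (f : Sector d n) : lp (fun _ : Occ d n => ℂ) 2 := f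

/-- The vector of the sector with given square summable coefficients. -/
def Sector.ofLp {d n : ℕ} (f : lp (fun _ : Occ d n => ℂ) 2) : Sector d n := f

instance (d n : ℕ) : CoeFun (Sector d n) (fun _ => Occ d n → ℂ) := ⟨fun f => ⇑f.toLp⟩

theorem Sector.norm_toLp {d n : ℕ} (f : Sector d n) : ‖f.toLp‖ = ‖f‖ := rfl

@[ext]
theorem Sector.ext {d n : ℕ} {f g : Sector d n} (h : ∀ c, f c = g c) : f = g :=
  lp.ext (funext h)

/-- One more particle in the mode `j`. -/
def addOne {d n : ℕ} (j : Mode d) (c : Occ d n) : Occ d (n + 1) :=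
  ⟨c.1 + Finsupp.single j 1, by rw [map_add, c.2, Finsupp.degree_single]⟩

theorem addOne_injective {d n : ℕ} (j : Mode d) :
    Function.Injective (addOne j : Occ d n → Occ d (n + 1)) := by
  intro c c' h
  have h1 := congrArg Subtype.val h
  exact Subtype.ext (add_right_cancel h1)

theorem occ_le {d n : ℕ} (j : Mode d) (c : Occ d n) : c.1 j ≤ n := by
  have h := Finsupp.le_degree j c.1
  rwa [c.2] at h

theorem sum_annih_le {d n : ℕ} (j : Mode d) (f : Sector d (n + 1)) (s : Finset (Occ d n)) :
    ∑ c ∈ s, ‖((Real.sqrt ((c.1 j : ℝ) + 1) : ℝ) : ℂ) * f (addOne j c)‖ ^ (2 : ℝ≥0∞).toReal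
      ≤ (Real.sqrt ((n : ℝ) + 1) * ‖f‖) ^ (2 : ℝ≥0∞).toReal := by
  have h2 : (2 : ℝ≥0∞).toReal = ((2 : ℕ) : ℝ) := by norm_num
  have hf := lp.norm_rpow_eq_tsum (p := 2) (by norm_num) f.toLp
  rw [f.norm_toLp] at hf
  have hs := (memℓp_gen_iff (p := 2) (by norm_num)).1 (lp.memℓp f.toLp)
  rw [h2] at hf hs ⊢
  simp only [Real.rpow_natCast] at hf hs ⊢
  rw [mul_pow, Real.sq_sqrt (by positivity), hf]
  calc ∑ c ∈ s, ‖((Real.sqrt ((c.1 j : ℝ) + 1) : ℝ) : ℂ) * f (addOne j c)‖ ^ 2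
      ≤ ∑ c ∈ s, ((n : ℝ) + 1) * ‖f (addOne j c)‖ ^ 2 := by
        refine Finset.sum_le_sum fun c _ => ?_
        rw [norm_mul, mul_pow, Complex.norm_real, Real.norm_eq_abs, sq_abs,
          Real.sq_sqrt (by positivity)]
        have : (c.1 j : ℝ) ≤ n := by exact_mod_cast occ_le j c
        gcongr
    _ = ((n : ℝ) + 1) * ∑ c ∈ s.map ⟨addOne j, addOne_injective j⟩, ‖f c‖ ^ 2 := by
        rw [Finset.mul_sum, Finset.sum_map]; rfl
    _ ≤ ((n : ℝ) + 1) * ∑' c, ‖f c‖ ^ 2 := by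
        gcongr
        exact hs.sum_le_tsum _ fun _ _ => by positivity

/-- The annihilation operator `a_j` from the `(n+1)`-particle to the `n`-particle sector:
`(a_j f)(c) = √(c_j + 1) f(c + 1_j)`. -/
def annihSucc {d : ℕ} (j : Mode d) (n : ℕ) : Sector d (n + 1) →L[ℂ] Sector d n :=
  LinearMap.mkContinuous
    { toFun := fun f =>
        Sector.ofLp ⟨fun c => ((Real.sqrt ((c.1 j : ℝ) + 1) : ℝ) : ℂ) * f (addOne j c),
          memℓp_gen' (sum_annih_le j f)⟩
      map_add' := fun f g => by
        ext c; exact mul_add _ _ _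
      map_smul' := fun a f => by
        ext c; exact mul_left_comm _ _ _ }
    (Real.sqrt ((n : ℝ) + 1))
    (fun f => lp.norm_le_of_forall_sum_le (by norm_num) (by positivity) (sum_annih_le j f))

/-- The annihilation operator `a_j` on the `n`-particle sector; it vanishes on the vacuum
sector. The creation operator `a_j^*` is its adjoint. -/
def annih {d : ℕ} (j : Mode d) : (n : ℕ) → Sector d n →L[ℂ] Sector d (n - 1)
  | 0 => 0
  | n + 1 => annihSucc j n

/-- The number operator `a_j^* a_j`. -/
def numOp {d : ℕ} (j : Mode d) (n : ℕ) : Sector d n →L[ℂ] Sector d n :=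
  (annih j n).adjoint ∘L annih j n

/-- `a_i a_j` on the `n`-particle sector. -/
def annih₂ {d : ℕ} (i j : Mode d) (n : ℕ) : Sector d n →L[ℂ] Sector d (n - 1 - 1) :=
  annih i (n - 1) ∘L annih j n

theorem sum_proj_le {d n : ℕ} (S : Set (Occ d n)) (f : Sector d n) (s : Finset (Occ d n)) :
    ∑ c ∈ s, ‖S.indicator f c‖ ^ (2 : ℝ≥0∞).toReal ≤ ‖f‖ ^ (2 : ℝ≥0∞).toReal := by
  have hf := lp.norm_rpow_eq_tsum (p := 2) (by norm_num) f.toLp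
  rw [f.norm_toLp] at hf
  have hs := (memℓp_gen_iff (p := 2) (by norm_num)).1 (lp.memℓp f.toLp)
  rw [hf]
  refine (Finset.sum_le_sum fun c _ => ?_).trans (hs.sum_le_tsum s fun _ _ => by positivity)
  gcongr
  exact norm_indicator_le_norm_self _ _

/-- The orthogonal projection onto the closed span of the product states in `S`. -/
def proj {d n : ℕ} (S : Set (Occ d n)) : Sector d n →L[ℂ] Sector d n :=
  LinearMap.mkContinuous
    { toFun := fun f => Sector.ofLp ⟨S.indicator f, memℓp_gen' (sum_proj_le S f)⟩
      map_add' := fun f g => by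
        ext c; exact congrFun (Set.indicator_add S f g) c
      map_smul' := fun a f => by
        ext c; exact congrFun (Set.indicator_const_smul S a f) c }
    1
    (fun f => by
      rw [one_mul]
      exact lp.norm_le_of_forall_sum_le (by norm_num) (norm_nonneg _) (sum_proj_le S f))

/-- The subspace of all `f` for which `w f` is square summable. -/
def mulDomain {d n : ℕ} (w : Occ d n → ℝ) : Submodule ℂ (Sector d n) where
  carrier := {f | Memℓp (fun c => (w c : ℂ) * f c) 2}
  add_mem' := fun {f g} hf hg => by
    have h : (fun c => (w c : ℂ) * (f + g) c) =
        (fun c => (w c : ℂ) * f c) + fun c => (w c : ℂ) * g c := by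
      funext c; exact mul_add _ _ _
    rw [Set.mem_ofPred_eq, h]
    exact Memℓp.add hf hg
  zero_mem' := by
    have h : (fun c => (w c : ℂ) * (0 : Sector d n) c) = 0 := by
      funext c; exact mul_zero _
    rw [Set.mem_ofPred_eq, h]
    exact zero_memℓp
  smul_mem' := fun a f hf => by
    have h : (fun c => (w c : ℂ) * (a • f) c) = a • fun c => (w c : ℂ) * f c := by
      funext c; exact mul_left_comm _ _ _
    rw [Set.mem_ofPred_eq, h]
    exact Memℓp.const_smul hf a

/-- The self-adjoint (in general unbounded) operator of multiplication by `w` in the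
occupation number basis, on its maximal domain. -/
def mulOp {d n : ℕ} (w : Occ d n → ℝ) : Sector d n →ₗ.[ℂ] Sector d n where
  domain := mulDomain w
  toFun :=
    { toFun := fun f => Sector.ofLp ⟨fun c => (w c : ℂ) * f.1 c, f.2⟩
      map_add' := fun f g => by
        ext c; exact mul_add _ _ _
      map_smul' := fun a f => by
        ext c; exact mul_left_comm _ _ _ }

/-! ### The three-modes Bogoliubov Hamiltonian -/

/-- The data of the three-modes system: `N` bosons in a `d`-dimensional periodic box of side
`L`, interacting through the modes `±jstar` with Fourier component `φ` of the pair potential. -/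
structure System (d : ℕ) where
  L : ℝ
  N : ℕ
  jstar : Mode d
  φ : ℝ

namespace System

variable {d : ℕ} (S : System d)

/-- The `N`-particle Hilbert space `𝓕^N`. -/
abbrev Space : Type := Sector d S.N

/-- `k_j²` with `k_j = (2π/L) j`. -/
def kSq (j : Mode d) : ℝ := ∑ a, (2 * Real.pi / S.L * (j a : ℝ)) ^ 2

/-- `Δ₀`, the smallest nonzero kinetic energy. -/
def gap : ℝ := sInf {x | ∃ j : Mode d, j ≠ 0 ∧ x = S.kSq j}

/-- `ε = k_{jstar}² / φ`. -/
def eps : ℝ := S.kSq S.jstar / S.φ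

/-- The Bogoliubov energy of the modes `±jstar`. -/
def energy : ℝ :=
  -(S.kSq S.jstar + S.φ - Real.sqrt (S.kSq S.jstar ^ 2 + 2 * S.φ * S.kSq S.jstar))

/-- `W = (φ/N) a_0^* a_0^* a_{jstar} a_{-jstar}`. -/
def W : S.Space →L[ℂ] S.Space :=
  ((S.φ / S.N : ℝ) : ℂ) •
    ((annih₂ 0 0 S.N).adjoint ∘L annih₂ S.jstar (-S.jstar) S.N)

/-- `W^* = (φ/N) a_0 a_0 a_{jstar}^* a_{-jstar}^*`. -/
def Wstar : S.Space →L[ℂ] S.Space := S.W.adjoint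

/-- `k_{jstar}² + φ a_0^* a_0 / N`. -/
def modeEnergy : S.Space →L[ℂ] S.Space :=
  ((S.kSq S.jstar : ℝ) : ℂ) • ContinuousLinearMap.id ℂ S.Space
    + ((S.φ / S.N : ℝ) : ℂ) • numOp 0 S.N

/-- The part of the Hamiltonian that involves the interacting modes:
`(k² + φ a_0^*a_0/N)(a_{jstar}^* a_{jstar} + a_{-jstar}^* a_{-jstar}) + W + W^*`. -/
def hamHat : S.Space →L[ℂ] S.Space :=
  S.modeEnergy ∘L numOp S.jstar S.N + S.modeEnergy ∘L numOp (-S.jstar) S.N + S.W + S.Wstar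

open Classical in
/-- Kinetic energy of the particles outside the modes `±jstar` in a product state. -/
def kinRest (c : Occ d S.N) : ℝ :=
  c.1.sum fun j m => if j = S.jstar ∨ j = -S.jstar then 0 else S.kSq j * m

/-- The Hamiltonian `H = ∑_{j ≠ ±jstar} k_j² a_j^* a_j + hamHat` on `𝓕^N`. -/
def ham : S.Space →ₗ.[ℂ] S.Space :=
  (S.hamHat : S.Space →ₗ[ℂ] S.Space) +ᵥ mulOp S.kinRest

/-! ### The Feshbach-Schur flow -/

/-- Number of particles in the modes `±jstar` in a product state. -/
def pairNum (c : Occ d S.N) : ℕ := c.1 S.jstar + c.1 (-S.jstar)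

/-- `Q^{(i,i+1)}`: exactly `N - i` or `N - i - 1` particles in the modes `±jstar`. -/
def Q (i : ℕ) : S.Space →L[ℂ] S.Space :=
  proj {c | S.pairNum c + i = S.N ∨ S.pairNum c + (i + 1) = S.N}

/-- `R` is the bounded inverse of `Q (H - z) Q` on the range of `Q`, extended by zero to the
orthogonal complement of that range. -/
def IsResolvent (H : S.Space →ₗ.[ℂ] S.Space) (P : S.Space →L[ℂ] S.Space) (z : ℝ)
    (R : S.Space →L[ℂ] S.Space) : Prop :=
  P ∘L R = R ∧ R ∘L P = R ∧
    (∀ ψ : S.Space, ∃ h : R ψ ∈ H.domain, P (H ⟨R ψ, h⟩ - (z : ℂ) • R ψ) = P ψ) ∧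
    (∀ ψ : H.domain, P ψ = ψ → R (P (H ψ - (z : ℂ) • (ψ : S.Space))) = ψ)

open Classical in
/-- `R_{i,i}(z) = Q^{(i,i+1)} (Q^{(i,i+1)} (H - z) Q^{(i,i+1)})⁻¹ Q^{(i,i+1)}`
(and `0` where this inverse does not exist). -/
def R (i : ℕ) (z : ℝ) : S.Space →L[ℂ] S.Space :=
  if h : ∃ T, S.IsResolvent S.ham (S.Q i) z T then h.choose else 0

/-- The square root `R_{i,i}(z)^{1/2}`. -/
def sqrtR (i : ℕ) (z : ℝ) : S.Space →L[ℂ] S.Space := CFC.sqrt (S.R i z)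

/-- `Γ_{i,i}(z)` for `i = 2 m`. The value `0` at `m = 0` makes the series at `i = 2` equal to
the identity, so that `Γ_{2,2} = W_{2,0} R_{0,0} W^*_{0,2}`; here
`W_{i,i-2} = Q^{(i,i+1)} W Q^{(i-2,i-1)}` and `W^*_{i-2,i} = Q^{(i-2,i-1)} W^* Q^{(i,i+1)}`. -/
def Γ (z : ℝ) : ℕ → (S.Space →L[ℂ] S.Space)
  | 0 => 0
  | m + 1 =>
      (S.Q (2 * (m + 1)) * S.W * S.Q (2 * m)) * S.R (2 * m) z *
        (∑' l : ℕ, (Γ z m * S.R (2 * m) z) ^ l) *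
        (S.Q (2 * m) * S.Wstar * S.Q (2 * (m + 1)))

/-- `Γ̌_{i,i}(z) = ∑_l [R_{i,i}(z)^{1/2} Γ_{i,i}(z) R_{i,i}(z)^{1/2}]^l` for `i = 2 m`;
it is the identity for `m = 0`. -/
def Γcheck (z : ℝ) (m : ℕ) : S.Space →L[ℂ] S.Space :=
  ∑' l : ℕ, (S.sqrtR (2 * m) z * S.Γ z m * S.sqrtR (2 * m) z) ^ l

/-- All the objects that enter the flow at `z` up to the step `i = N - 2` are well defined:
the resolvents exist as bounded positive operators and the series converge in norm. -/
def FlowWellDefined (z : ℝ) : Prop :=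
  ∀ m : ℕ, 2 * m + 2 ≤ S.N →
    S.IsResolvent S.ham (S.Q (2 * m)) z (S.R (2 * m) z) ∧
    (S.R (2 * m) z).IsPositive ∧
    Summable (fun l : ℕ => (S.Γ z m * S.R (2 * m) z) ^ l) ∧
    Summable (fun l : ℕ => (S.sqrtR (2 * m) z * S.Γ z m * S.sqrtR (2 * m) z) ^ l)

/-- `W R_{N-2,N-2}(z)^{1/2} Γ̌_{N-2,N-2}(z) R_{N-2,N-2}(z)^{1/2} W^*`, for even `N ≥ 2`. -/
def effective (z : ℝ) : S.Space →L[ℂ] S.Space :=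
  S.W * S.sqrtR (S.N - 2) z * S.Γcheck z ((S.N - 2) / 2) * S.sqrtR (S.N - 2) z * S.Wstar

open Classical in
/-- `η`, the normalized state with all the `N` particles in the zero mode. -/
def η : S.Space :=
  Sector.ofLp <| lp.single 2 (⟨Finsupp.single 0 S.N, Finsupp.degree_single _ _⟩ : Occ d S.N) (1 : ℂ)

/-- `|η⟩⟨η|`. -/
def Pη : S.Space →L[ℂ] S.Space := InnerProductSpace.rankOne ℂ S.η S.η

/-- The complement of `|η⟩⟨η|` in the subspace of states without particles in the modes
`±jstar`. -/
def PηPerp : S.Space →L[ℂ] S.Space := proj {c | S.pairNum c = 0} - S.Pη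

end System

end Bog

end

/-!
`W` lowers the number of particles in the modes `±jstar` by two, so `Q i * W * Q i = 0` and every
operator of the flow is diagonal in the occupation number basis. The eigenvalues of `Γ` satisfy a
scalar continued fraction recursion along the orbit of `c` under the transfer of pairs from the
condensate to the modes `±jstar`.

Below the threshold, this recursion has a supersolution, proportional to the density of the
condensate and to the Bogoliubov energy, which is at most `9 / 10` of the energy denominators.
Hence all the geometric series converge, and the norms of the sandwiched effective operators are
suprema of eigenvalues.

The recursion is monotone. Among the states without particles in the modes `±jstar`, `η` has the
largest condensate and the smallest kinetic energy: the kinetic energy of any other one is at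
least the gap, and so remains larger when the spectral parameter of `η` is lowered by half the
gap. The eigenvalue at `η` therefore dominates all the others, without an error term.
-/

namespace Bog

section HilbertBasis

variable {ι κ μ 𝕜 E F G : Type*} [RCLike 𝕜]
  [NormedAddCommGroup E] [InnerProductSpace 𝕜 E]
  [NormedAddCommGroup F] [InnerProductSpace 𝕜 F]
  [NormedAddCommGroup G] [InnerProductSpace 𝕜 G]
  {b : HilbertBasis ι 𝕜 E} {b' : HilbertBasis κ 𝕜 F} {b'' : HilbertBasis μ 𝕜 G}

/-- `A` is a weighted composition operator in the coordinates given by the Hilbert bases `b` and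
`b'`: it sends the coordinate function `x` to `k ↦ a k * x (s k)`. Products of annihilation
operators are of this form in the occupation number bases. -/
def IsWeightedComp (b : HilbertBasis ι 𝕜 E) (b' : HilbertBasis κ 𝕜 F) (A : E →L[𝕜] F)
    (a : κ → ℝ) (s : κ → ι) : Prop :=
  ∀ f k, b'.repr (A f) k = (a k : 𝕜) * b.repr f (s k)

/-- `A` is diagonal in the Hilbert basis `b` with eigenvalues `a`, which are taken to be real. -/
def IsDiag (b : HilbertBasis ι 𝕜 E) (A : E →L[𝕜] E) (a : ι → ℝ) : Prop :=
  ∀ f i, b.repr (A f) i = (a i : 𝕜) * b.repr f i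

theorem eq_of_repr_apply_eq {f g : E} (h : ∀ i, b.repr f i = b.repr g i) : f = g :=
  b.repr.injective <| lp.ext <| funext h

theorem repr_self_apply [DecidableEq ι] (i j : ι) :
    b.repr (b i) j = if j = i then 1 else 0 := by
  rw [b.repr_self, lp.single_apply, Pi.single_apply]

namespace IsWeightedComp

variable {A : E →L[𝕜] F} {a : κ → ℝ} {s : κ → ι} {t : Set κ}

theorem comp {B : F →L[𝕜] G} {w : μ → ℝ} {r : μ → κ} (hB : IsWeightedComp b' b'' B w r)
    (hA : IsWeightedComp b b' A a s) :
    IsWeightedComp b b'' (B ∘L A) (fun l => w l * a (r l)) (s ∘ r) := by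
  intro f l
  rw [ContinuousLinearMap.comp_apply, hB, hA, RCLike.ofReal_mul, mul_assoc, Function.comp_apply]

theorem smul (hA : IsWeightedComp b b' A a s) (x : ℝ) :
    IsWeightedComp b b' ((x : 𝕜) • A) (fun k => x * a k) s := by
  intro f k
  rw [smul_apply, map_smul, lp.coeFn_smul, Pi.smul_apply, hA, smul_eq_mul,
    RCLike.ofReal_mul, mul_assoc]

theorem apply_basis (hA : IsWeightedComp b b' A a s) (ha : ∀ k ∉ t, a k = 0)
    (hs : Set.InjOn s t) {k : κ} (hk : k ∈ t) : A (b (s k)) = (a k : 𝕜) • b' k := by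
  classical
  refine eq_of_repr_apply_eq (b := b') fun l => ?_
  rw [hA, map_smul, lp.coeFn_smul, Pi.smul_apply, repr_self_apply, repr_self_apply, smul_eq_mul]
  by_cases hl : l ∈ t
  · rcases eq_or_ne l k with rfl | hlk
    · simp only [if_true]
    · simp only [(hs.eq_iff hl hk).not.2 hlk, hlk, if_false, mul_zero]
  · have hlk : l ≠ k := fun h => hl (h ▸ hk)
    simp only [ha l hl, RCLike.ofReal_zero, zero_mul, hlk, if_false, mul_zero]

theorem apply_basis_of_notMem (hA : IsWeightedComp b b' A a s) (ha : ∀ k ∉ t, a k = 0) {i : ι}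
    (hi : i ∉ s '' t) : A (b i) = 0 := by
  classical
  refine eq_of_repr_apply_eq (b := b') fun k => ?_
  rw [hA, repr_self_apply, map_zero, lp.coeFn_zero, Pi.zero_apply]
  by_cases hk : k ∈ t
  · rw [if_neg fun h => hi ⟨k, hk, h⟩, mul_zero]
  · rw [ha k hk, RCLike.ofReal_zero, zero_mul]

variable [CompleteSpace E] [CompleteSpace F]

theorem adjoint_apply (hA : IsWeightedComp b b' A a s) (ha : ∀ k ∉ t, a k = 0)
    (hs : Set.InjOn s t) {k : κ} (hk : k ∈ t) (g : F) :
    b.repr (A.adjoint g) (s k) = (a k : 𝕜) * b'.repr g k := by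
  rw [b.repr_apply_apply, ContinuousLinearMap.adjoint_inner_right, hA.apply_basis ha hs hk,
    inner_smul_left, RCLike.conj_ofReal, b'.repr_apply_apply]

theorem adjoint_apply_of_notMem (hA : IsWeightedComp b b' A a s) (ha : ∀ k ∉ t, a k = 0) {i : ι}
    (hi : i ∉ s '' t) (g : F) : b.repr (A.adjoint g) i = 0 := by
  rw [b.repr_apply_apply, ContinuousLinearMap.adjoint_inner_right, hA.apply_basis_of_notMem ha hi,
    inner_zero_left]

theorem isDiag_comp_comp_adjoint (hA : IsWeightedComp b b' A a s) (ha : ∀ k ∉ t, a k = 0)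
    (hs : Set.InjOn s t) {D : E →L[𝕜] E} {w : ι → ℝ} (hD : IsDiag b D w) :
    IsDiag b' (A ∘L D ∘L A.adjoint) (fun k => a k ^ 2 * w (s k)) := by
  intro g k
  rw [ContinuousLinearMap.comp_apply, ContinuousLinearMap.comp_apply, hA, hD]
  by_cases hk : k ∈ t
  · rw [hA.adjoint_apply ha hs hk]
    push_cast
    ring
  · simp only [ha k hk, RCLike.ofReal_zero, zero_mul, zero_pow two_ne_zero]

theorem adjoint_comp {C : G →L[𝕜] F} {c : κ → ℝ} {s' : κ → μ}
    (hA : IsWeightedComp b b' A a s) (hs : Function.Injective s)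
    (hC : IsWeightedComp b'' b' C c s') {w : ι → ℝ} {r : ι → μ}
    (hw : ∀ k, w (s k) = a k * c k) (hw0 : ∀ i ∉ Set.range s, w i = 0)
    (hr : ∀ k, r (s k) = s' k) :
    IsWeightedComp b'' b (A.adjoint ∘L C) w r := by
  intro f i
  rw [ContinuousLinearMap.comp_apply]
  by_cases hi : i ∈ Set.range s
  · obtain ⟨k, rfl⟩ := hi
    rw [hA.adjoint_apply (fun k hk => absurd (Set.mem_univ k) hk) hs.injOn (Set.mem_univ k), hC,
      hw, hr, RCLike.ofReal_mul, mul_assoc]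
  · rw [hA.adjoint_apply_of_notMem (fun k hk => absurd (Set.mem_univ k) hk)
      (Set.image_univ ▸ hi), hw0 i hi, RCLike.ofReal_zero, zero_mul]

end IsWeightedComp

namespace IsDiag

variable {A B : E →L[𝕜] E} {a w : ι → ℝ}

theorem ext (hA : IsDiag b A a) (hB : IsDiag b B a) : A = B :=
  ContinuousLinearMap.ext fun f => eq_of_repr_apply_eq fun i => by rw [hA, hB]

theorem congr (hA : IsDiag b A a) (h : ∀ i, a i = w i) : IsDiag b A w := by
  rwa [← funext h]

theorem mul (hA : IsDiag b A a) (hB : IsDiag b B w) : IsDiag b (A * B) (fun i => a i * w i) := by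
  intro f i
  rw [mul_apply_eq_comp, hA, hB, RCLike.ofReal_mul, mul_assoc]

theorem sub (hA : IsDiag b A a) (hB : IsDiag b B w) : IsDiag b (A - B) (fun i => a i - w i) := by
  intro f i
  rw [sub_apply, map_sub, lp.coeFn_sub, Pi.sub_apply, hA, hB,
    RCLike.ofReal_sub, sub_mul]

theorem one : IsDiag b (1 : E →L[𝕜] E) (fun _ => 1) := by
  intro f i
  rw [one_apply_eq_self, RCLike.ofReal_one, one_mul]

theorem rankOne (b : HilbertBasis ι 𝕜 E) (i : ι) :
    IsDiag b (InnerProductSpace.rankOne 𝕜 (b i) (b i)) (({i} : Set ι).indicator 1) := by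
  classical
  intro f k
  rw [InnerProductSpace.rankOne_apply, map_smul, lp.coeFn_smul, Pi.smul_apply, repr_self_apply,
    ← b.repr_apply_apply, smul_eq_mul]
  by_cases hk : k = i
  · subst hk
    simp
  · simp [hk]

theorem abs_le_norm (hA : IsDiag b A a) (i : ι) : |a i| ≤ ‖A‖ := by
  classical
  have h_coord : ‖b.repr (A (b i)) i‖ ≤ ‖A (b i)‖ := by
    rw [← b.repr.norm_map]
    exact lp.norm_apply_le_norm two_ne_zero _ i
  rw [hA, repr_self_apply, if_pos rfl, mul_one, RCLike.norm_ofReal] at h_coord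
  exact h_coord.trans (A.unit_le_opNorm _ (b.orthonormal.1 i).le)

theorem exists_of_bounded (b : HilbertBasis ι 𝕜 E) (a : ι → ℝ) {q : ℝ} (hq : 0 ≤ q)
    (h : ∀ i, |a i| ≤ q) : ∃ A : E →L[𝕜] E, IsDiag b A a ∧ ‖A‖ ≤ q := by
  let M : lp (fun _ : ι => 𝕜) 2 →L[𝕜] lp (fun _ : ι => 𝕜) 2 :=
    lp.mapCLM 2 (fun i => (a i : 𝕜) • ContinuousLinearMap.id 𝕜 𝕜) hq fun i => by
      rw [norm_smul, RCLike.norm_ofReal]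
      exact mul_le_of_le_one_right (abs_nonneg _) ContinuousLinearMap.norm_id_le |>.trans (h i)
  refine ⟨b.repr.symm.toLinearIsometry.toContinuousLinearMap ∘L M ∘L
    b.repr.toLinearIsometry.toContinuousLinearMap, fun f i => ?_, ?_⟩
  · change b.repr (b.repr.symm (M (b.repr f))) i = _
    rw [b.repr.apply_symm_apply]
    rfl
  · refine ContinuousLinearMap.opNorm_le_bound _ hq fun f => ?_
    change ‖b.repr.symm (M (b.repr f))‖ ≤ _
    rw [b.repr.symm.norm_map, ← b.repr.norm_map f]
    exact M.le_of_opNorm_le (lp.norm_mapCLM_le ..) _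

theorem norm_le (hA : IsDiag b A a) {q : ℝ} (hq : 0 ≤ q) (h : ∀ i, |a i| ≤ q) : ‖A‖ ≤ q := by
  obtain ⟨B, hB, hBq⟩ := exists_of_bounded b a hq h
  rwa [hA.ext hB]

theorem isSymmetric (hA : IsDiag b A a) : A.IsSymmetric := by
  intro f g
  change ⟪A f, g⟫_𝕜 = ⟪f, A g⟫_𝕜
  rw [← b.repr.inner_map_map, ← b.repr.inner_map_map, lp.inner_eq_tsum, lp.inner_eq_tsum]
  refine tsum_congr fun i => ?_
  rw [hA, hA, ← smul_eq_mul, ← smul_eq_mul, inner_smul_left, inner_smul_right, RCLike.conj_ofReal]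

theorem exists_mul_self_eq (hA : IsDiag b A a) (h : ∀ i, 0 ≤ a i) :
    ∃ B : E →L[𝕜] E, IsDiag b B (fun i => √(a i)) ∧ B * B = A := by
  obtain ⟨B, hB, -⟩ := exists_of_bounded b (fun i => √(a i)) (Real.sqrt_nonneg ‖A‖) fun i => by
    rw [abs_of_nonneg (Real.sqrt_nonneg _)]
    exact Real.sqrt_le_sqrt ((le_abs_self _).trans (hA.abs_le_norm i))
  exact ⟨B, hB, ((hB.mul hB).congr fun i => Real.mul_self_sqrt (h i)).ext hA⟩

theorem isPositive (hA : IsDiag b A a) (h : ∀ i, 0 ≤ a i) : A.IsPositive := by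
  obtain ⟨B, hB, rfl⟩ := hA.exists_mul_self_eq h
  refine ContinuousLinearMap.isPositive_def.2 ⟨hA.isSymmetric, fun f => ?_⟩
  have h_inner : ⟪(B * B) f, f⟫_𝕜 = ⟪B f, B f⟫_𝕜 := hB.isSymmetric (B f) f
  rw [ContinuousLinearMap.reApplyInnerSelf_apply, h_inner]
  exact inner_self_nonneg

theorem summable_pow [CompleteSpace E] (hA : IsDiag b A a) {q : ℝ} (hq0 : 0 ≤ q) (hq : q < 1)
    (h : ∀ i, |a i| ≤ q) : Summable (fun l : ℕ => A ^ l) :=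
  summable_geometric_of_norm_lt_one ((hA.norm_le hq0 h).trans_lt hq)

theorem tsum_pow [CompleteSpace E] (hA : IsDiag b A a) {q : ℝ} (hq0 : 0 ≤ q) (hq : q < 1)
    (h : ∀ i, |a i| ≤ q) : IsDiag b (∑' l : ℕ, A ^ l) (fun i => (1 - a i)⁻¹) := by
  intro f i
  have h_inv := mul_neg_geom_series A ((hA.norm_le hq0 h).trans_lt hq)
  have h_apply := (one.sub hA) ((∑' l : ℕ, A ^ l) f) i
  rw [← mul_apply_eq_comp, h_inv, one_apply_eq_self] at h_apply
  have h_ne : (1 - a i : ℝ) ≠ 0 := by linarith [(le_abs_self _).trans (h i)]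
  rw [h_apply, ← mul_assoc, ← RCLike.ofReal_mul, inv_mul_cancel₀ h_ne, RCLike.ofReal_one, one_mul]

end IsDiag

end HilbertBasis

theorem IsDiag.sqrt {ι E : Type*} [NormedAddCommGroup E] [InnerProductSpace ℂ E] [CompleteSpace E]
    {b : HilbertBasis ι ℂ E} {A : E →L[ℂ] E} {a : ι → ℝ} (hA : IsDiag b A a)
    (h : ∀ i, 0 ≤ a i) : IsDiag b (CFC.sqrt A) (fun i => √(a i)) := by
  obtain ⟨B, hB, h_sq⟩ := hA.exists_mul_self_eq h
  have h_nonneg : 0 ≤ B :=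
    (ContinuousLinearMap.nonneg_iff_isPositive B).2 (hB.isPositive fun i => Real.sqrt_nonneg _)
  rwa [CFC.sqrt_unique h_sq h_nonneg]

section Supersolution

/-- The elementary excitation energy `√(ε² + 2ε)` of the modes `±jstar`, in units of `φ`. -/
noncomputable def excitation (ε : ℝ) : ℝ := √(ε ^ 2 + 2 * ε)

/-- The Bogoliubov energy of the modes `±jstar`, in units of `-φ`. -/
noncomputable def bogRatio (ε : ℝ) : ℝ := 1 + ε - excitation ε

/-- The upper end of the range of spectral parameters, in units of `-φ`. -/
noncomputable def threshold (ε : ℝ) : ℝ := bogRatio ε - √ε * excitation ε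

variable {ε : ℝ}

theorem sq_excitation (hε : 0 ≤ ε) : excitation ε ^ 2 = ε ^ 2 + 2 * ε :=
  Real.sq_sqrt (by positivity)

theorem bogRatio_mul_bogRatio_add (hε : 0 ≤ ε) :
    bogRatio ε * (bogRatio ε + 2 * excitation ε) = 1 := by
  rw [bogRatio]
  linear_combination -sq_excitation hε

theorem sqrt_le_one_div_ten (hε : ε ≤ 1 / 100) : √ε ≤ 1 / 10 :=
  (Real.sqrt_le_left (by norm_num)).2 (by linarith)

theorem le_excitation (hε : 0 ≤ ε) : 7 / 5 * √ε ≤ excitation ε := by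
  refine Real.le_sqrt_of_sq_le ?_
  rw [mul_pow, Real.sq_sqrt hε]
  nlinarith

theorem excitation_le (hε : 0 ≤ ε) (hε' : ε ≤ 1 / 100) : excitation ε ≤ 3 / 20 :=
  (Real.sqrt_le_left (by norm_num)).2 (by nlinarith)

theorem le_bogRatio (hε : 0 ≤ ε) (hε' : ε ≤ 1 / 100) : 17 / 20 ≤ bogRatio ε := by
  rw [bogRatio]
  linarith [excitation_le hε hε']

theorem bogRatio_le_one (hε : 0 ≤ ε) : bogRatio ε ≤ 1 := by
  have h : ε ≤ excitation ε := Real.le_sqrt_of_sq_le (by linarith)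
  rw [bogRatio]
  linarith

theorem sqrt_mul_excitation_le (hε : 0 ≤ ε) (hε' : ε ≤ 1 / 100) :
    √ε * excitation ε ≤ 3 / 200 := by
  have h := mul_le_mul (sqrt_le_one_div_ten hε') (excitation_le hε hε') (Real.sqrt_nonneg _)
    (by norm_num)
  linarith

theorem le_threshold (hε : 0 ≤ ε) (hε' : ε ≤ 1 / 100) : 4 / 5 ≤ threshold ε := by
  rw [threshold]
  linarith [le_bogRatio hε hε', sqrt_mul_excitation_le hε hε']

/-- In the limit of infinitely many particles, with `s` the condensate fraction and `2 * a` the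
number of particles in the modes `±jstar`, this says that `bogRatio ε * (a + √ε) * s` is a
supersolution of the recursion for the eigenvalues of `Γ`; `w` absorbs the `1 / N` corrections. -/
theorem mul_sq_le_bogRatio_mul (hε : 0 ≤ ε) (hε' : ε ≤ 1 / 100) {s a w : ℝ} (hs : 0 ≤ s)
    (ha : 1 ≤ a) (hw : 0 ≤ w) (hsw : 2 * a * w ≤ 1 - s) :
    (s + w) * a ^ 2 ≤ bogRatio ε * (a + √ε) *
      ((ε + s) * (2 * a) + threshold ε - bogRatio ε * (a + 1 + √ε) * s) := by
  have hσ := Real.sqrt_nonneg ε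
  have hq := le_excitation hε
  have ht := le_bogRatio hε hε'
  have hσq := sqrt_mul_excitation_le hε hε'
  have h_prod := bogRatio_mul_bogRatio_add hε
  have h_sum : bogRatio ε = 1 + ε - excitation ε := rfl
  rw [threshold]
  set σ := √ε
  set q := excitation ε
  set t := bogRatio ε
  have h_affine : t * ((ε + s) * (2 * a) + (t - σ * q) - t * (a + 1 + σ) * s) =
      (1 - s) * (t * (2 * a * ε + (t - σ * q))) + s * (a - σ * (1 - t * q)) := by
    linear_combination s * (a - σ) * h_prod - 2 * a * s * t * h_sum
  have h_zero : a / 2 ≤ (a + σ) * (t * (2 * a * ε + (t - σ * q))) := by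
    have h : 1 / 2 ≤ t * (2 * a * ε + (t - σ * q)) := by
      have : 0 ≤ a * ε := by positivity
      nlinarith
    nlinarith
  have h_one : a ^ 2 ≤ (a + σ) * (a - σ * (1 - t * q)) := by
    have h : σ ≤ t * q := by nlinarith
    have h' : σ ≤ (a + σ) * (t * q) := by nlinarith
    linarith [mul_nonneg hσ (sub_nonneg.2 h')]
  have hs1 : 0 ≤ 1 - s := le_trans (by positivity) hsw
  calc (s + w) * a ^ 2 = s * a ^ 2 + a / 2 * (2 * a * w) := by ring
    _ ≤ s * a ^ 2 + a / 2 * (1 - s) := by gcongr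
    _ ≤ s * ((a + σ) * (a - σ * (1 - t * q))) +
        (a + σ) * (t * (2 * a * ε + (t - σ * q))) * (1 - s) := by gcongr
    _ = t * (a + σ) * ((ε + s) * (2 * a) + (t - σ * q) - t * (a + 1 + σ) * s) := by
        linear_combination -(a + σ) * h_affine

theorem bogRatio_mul_le_nine_tenths_mul (hε : 0 ≤ ε) (hε' : ε ≤ 1 / 100) {s p : ℝ}
    (hs : 0 ≤ s) (hs1 : s ≤ 1) (hp : 1 ≤ p) :
    bogRatio ε * (p / 2 + 1 + √ε) * s ≤ 9 / 10 * ((ε + s) * p + threshold ε) := by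
  have h_sqrt := sqrt_le_one_div_ten hε'
  have h_thr := le_threshold hε hε'
  calc bogRatio ε * (p / 2 + 1 + √ε) * s ≤ 1 * (p / 2 + 1 + 1 / 10) * s := by
        gcongr
        exact bogRatio_le_one hε
    _ ≤ 9 / 10 * (s * p + threshold ε) := by nlinarith
    _ ≤ 9 / 10 * ((ε + s) * p + threshold ε) := by
        gcongr
        linarith

end Supersolution

theorem mul_sub_one_div_mul_le {u u' e e' : ℝ} (hu : 1 ≤ u) (huu' : u ≤ u') (he : 0 < e)
    (he' : 0 < e') (h : (u - 1) * e' ≤ (u' - 1) * e) :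
    u * (u - 1) / e * (u' + 1) ≤ u' * (u' - 1) / e' * (u + 1) := by
  have h_ratio : (u - 1) / e ≤ (u' - 1) / e' := (div_le_div_iff₀ he he').2 h
  have h_succ : u * (u' + 1) ≤ u' * (u + 1) := by linarith
  calc u * (u - 1) / e * (u' + 1) = u * (u' + 1) * ((u - 1) / e) := by ring
    _ ≤ u' * (u + 1) * ((u' - 1) / e') :=
      mul_le_mul h_succ h_ratio (div_nonneg (by linarith) he.le) (by nlinarith)
    _ = u' * (u' - 1) / e' * (u + 1) := by ring

section Occupation

variable {d n : ℕ}

/-- The product states of plane waves, as a Hilbert basis of the `n`-particle sector. -/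
noncomputable def occBasis (d n : ℕ) : HilbertBasis (Occ d n) ℂ (Sector d n) :=
  .ofRepr (LinearIsometryEquiv.refl ℂ (lp (fun _ : Occ d n => ℂ) 2))

theorem occBasis_repr_apply (f : Sector d n) (c : Occ d n) : (occBasis d n).repr f c = f c := rfl

theorem IsDiag.apply_occ {A : Sector d n →L[ℂ] Sector d n} {a : Occ d n → ℝ}
    (hA : IsDiag (occBasis d n) A a) (f : Sector d n) (c : Occ d n) :
    A f c = (a c : ℂ) * f c :=
  hA f c

theorem isDiag_proj (s : Set (Occ d n)) : IsDiag (occBasis d n) (proj s) (s.indicator 1) := by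
  classical
  intro f c
  change s.indicator f c = _ * f c
  by_cases hc : c ∈ s <;> simp [hc]

theorem coe_addOne (j : Mode d) (c : Occ d n) : (addOne j c).1 = c.1 + Finsupp.single j 1 := rfl

theorem mem_range_addOne {j : Mode d} {c : Occ d (n + 1)} :
    c ∈ Set.range (addOne (n := n) j) ↔ c.1 j ≠ 0 := by
  constructor
  · rintro ⟨c', rfl⟩
    simp [coe_addOne]
  · intro h
    have h_add : c.1 - Finsupp.single j 1 + Finsupp.single j 1 = c.1 :=
      tsub_add_cancel_of_le (Finsupp.single_le_iff.2 (Nat.one_le_iff_ne_zero.2 h))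
    have h_degree := congrArg Finsupp.degree h_add
    rw [map_add, c.2, Finsupp.degree_single] at h_degree
    exact ⟨⟨c.1 - Finsupp.single j 1, add_right_cancel h_degree⟩, Subtype.ext h_add⟩

theorem isWeightedComp_annihSucc (j : Mode d) :
    IsWeightedComp (occBasis d (n + 1)) (occBasis d n) (annihSucc j n)
      (fun c => √((c.1 j : ℝ) + 1)) (addOne j) :=
  fun _ _ => rfl

theorem isWeightedComp_annih₂ (i j : Mode d) :
    IsWeightedComp (occBasis d (n + 2)) (occBasis d n) (annih₂ i j (n + 2))
      (fun c => √((c.1 i : ℝ) + 1) * √(((addOne i c).1 j : ℝ) + 1)) (addOne j ∘ addOne i) :=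
  (isWeightedComp_annihSucc i).comp (isWeightedComp_annihSucc j)

theorem annih₂_of_lt_two (hn : n < 2) (i j : Mode d) : annih₂ i j n = 0 := by
  match n with
  | 0 => exact (annih i 0).comp_zero
  | 1 => exact (annihSucc j 0).zero_comp

theorem isDiag_numOp (j : Mode d) (n : ℕ) :
    IsDiag (occBasis d n) (numOp j n) (fun c => (c.1 j : ℝ)) := by
  cases n with
  | zero =>
    intro f c
    have hc : c.1 j = 0 := Nat.le_zero.1 (occ_le j c)
    have h_zero : numOp j 0 f = 0 := map_zero (annih j 0).adjoint
    simp only [h_zero, hc, map_zero, lp.coeFn_zero, Pi.zero_apply, Nat.cast_zero, zero_mul]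
  | succ n =>
    refine (isWeightedComp_annihSucc j).adjoint_comp (addOne_injective j)
      (isWeightedComp_annihSucc j) (r := id) (fun c => ?_) (fun c hc => ?_) fun _ => rfl
    · rw [Real.mul_self_sqrt (by positivity)]
      simp [coe_addOne]
    · rw [mem_range_addOne, not_ne_iff] at hc
      rw [hc, Nat.cast_zero]

end Occupation

section PairShift

variable {d n : ℕ} {i j : Mode d} {c c' : Occ d n}

/-- Two particles are moved from the zero mode to the modes `±j`, if there are two in the zero
mode; otherwise nothing happens. -/
noncomputable def pairShift (j : Mode d) (c : Occ d n) : Occ d n :=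
  if h : 2 ≤ c.1 0 then
    ⟨c.1 - Finsupp.single 0 2 + Finsupp.single j 1 + Finsupp.single (-j) 1, by
      have hle : Finsupp.single 0 2 ≤ c.1 := Finsupp.single_le_iff.2 h
      have h_degree := congrArg Finsupp.degree (tsub_add_cancel_of_le hle)
      rw [map_add, c.2, Finsupp.degree_single] at h_degree
      rw [map_add, map_add, Finsupp.degree_single, Finsupp.degree_single, add_assoc, h_degree]⟩
  else c

theorem coe_pairShift (h : 2 ≤ c.1 0) :
    (pairShift j c).1 = c.1 - Finsupp.single 0 2 + Finsupp.single j 1 + Finsupp.single (-j) 1 := by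
  rw [pairShift, dif_pos h]

theorem pairShift_zero (hj : j ≠ 0) (h : 2 ≤ c.1 0) : (pairShift j c).1 0 = c.1 0 - 2 := by
  rw [coe_pairShift h]
  simp [hj]

theorem pairShift_self (hj : j ≠ 0) (h : 2 ≤ c.1 0) : (pairShift j c).1 j = c.1 j + 1 := by
  rw [coe_pairShift h]
  simp [hj.symm, (neg_ne_self.2 hj)]

theorem pairShift_neg (hj : j ≠ 0) (h : 2 ≤ c.1 0) : (pairShift j c).1 (-j) = c.1 (-j) + 1 := by
  rw [coe_pairShift h]
  simp [hj, (neg_ne_self.2 hj).symm]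

theorem pairShift_of_ne (h0 : i ≠ 0) (hj : i ≠ j) (hnj : i ≠ -j) (h : 2 ≤ c.1 0) :
    (pairShift j c).1 i = c.1 i := by
  rw [coe_pairShift h]
  simp [h0.symm, hj.symm, hnj.symm]

theorem pairShift_injOn (j : Mode d) :
    Set.InjOn (pairShift j) {c : Occ d n | 2 ≤ c.1 0} := by
  intro c hc c' hc' h
  have h_coe := congrArg Subtype.val h
  rw [coe_pairShift hc, coe_pairShift hc', add_left_inj, add_left_inj] at h_coe
  exact Subtype.ext <|
    (tsub_left_inj (Finsupp.single_le_iff.2 hc) (Finsupp.single_le_iff.2 hc')).1 h_coe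

theorem pairShift_addOne_addOne (c : Occ d n) :
    pairShift j (addOne 0 (addOne 0 c)) = addOne (-j) (addOne j c) := by
  have h : (addOne 0 (addOne 0 c)).1 = c.1 + Finsupp.single 0 2 := by
    rw [coe_addOne, coe_addOne, add_assoc, ← Finsupp.single_add]
  refine Subtype.ext ?_
  rw [coe_pairShift (by simp [h]), h, add_tsub_cancel_right, coe_addOne, coe_addOne]

/-- The square of the matrix element of `a_0^* a_0^* a_j a_{-j}` between `c` and `pairShift j c`. -/
def pairAmpSq (j : Mode d) (c : Occ d n) : ℝ :=
  (c.1 0 : ℝ) * ((c.1 0 : ℝ) - 1) * (((c.1 j : ℝ) + 1) * ((c.1 (-j) : ℝ) + 1))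

theorem pairAmpSq_of_lt (h : c.1 0 < 2) : pairAmpSq j c = 0 := by
  unfold pairAmpSq
  interval_cases c.1 0 <;> simp

theorem pairAmpSq_nonneg (j : Mode d) (c : Occ d n) : 0 ≤ pairAmpSq j c := by
  rcases lt_or_ge (c.1 0) 2 with h | h
  · rw [pairAmpSq_of_lt h]
  · have h_one : (0 : ℝ) ≤ (c.1 0 : ℝ) - 1 := sub_nonneg.2 (by exact_mod_cast one_le_two.trans h)
    unfold pairAmpSq
    positivity

theorem sqrt_pairAmpSq_addOne_addOne (hj : j ≠ 0) (c : Occ d n) :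
    √(pairAmpSq j (addOne 0 (addOne 0 c))) =
      √((c.1 0 : ℝ) + 1) * √(((addOne 0 c).1 0 : ℝ) + 1) *
        (√((c.1 j : ℝ) + 1) * √(((addOne j c).1 (-j) : ℝ) + 1)) := by
  rw [← Real.sqrt_mul (by positivity), ← Real.sqrt_mul (by positivity),
    ← Real.sqrt_mul (by positivity), pairAmpSq]
  congr 1
  simp only [coe_addOne, Finsupp.add_apply, Finsupp.single_eq_same,
    Finsupp.single_eq_of_ne hj, Finsupp.single_eq_of_ne (neg_ne_zero.2 hj),
    Finsupp.single_eq_of_ne (neg_ne_self.2 hj)]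
  push_cast
  ring

theorem isWeightedComp_pairOp (hj : j ≠ 0) (n : ℕ) :
    IsWeightedComp (occBasis d n) (occBasis d n) ((annih₂ 0 0 n).adjoint ∘L annih₂ j (-j) n)
      (fun c => √(pairAmpSq j c)) (pairShift j) := by
  rcases lt_or_ge n 2 with hn | hn
  · intro f c
    simp only [annih₂_of_lt_two hn, pairAmpSq_of_lt ((occ_le 0 c).trans_lt hn),
      ContinuousLinearMap.comp_zero, zero_apply, map_zero, lp.coeFn_zero, Pi.zero_apply,
      Real.sqrt_zero, zero_mul]
  · obtain ⟨n, rfl⟩ := Nat.exists_eq_add_of_le' hn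
    refine (isWeightedComp_annih₂ 0 0).adjoint_comp
      ((addOne_injective 0).comp (addOne_injective 0)) (isWeightedComp_annih₂ j (-j))
      (sqrt_pairAmpSq_addOne_addOne hj) (fun c hc => ?_) pairShift_addOne_addOne
    suffices h : c.1 0 < 2 by rw [pairAmpSq_of_lt h, Real.sqrt_zero]
    by_contra! h
    obtain ⟨c', rfl⟩ := mem_range_addOne.2 (two_pos.trans_le h).ne'
    have hc' : c'.1 0 ≠ 0 := by simpa [coe_addOne, Nat.one_le_iff_ne_zero] using h
    obtain ⟨c'', rfl⟩ := mem_range_addOne.2 hc'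
    exact hc ⟨c'', rfl⟩

end PairShift

namespace System

section Hamiltonian

variable {d : ℕ} (S : System d)

/-- The matrix element of `W` between `c` and `pairShift S.jstar c`. -/
noncomputable def hop (c : Occ d S.N) : ℝ := S.φ / S.N * √(pairAmpSq S.jstar c)

/-- The diagonal matrix element of the Hamiltonian in the product state `c`. -/
noncomputable def diagEnergy (c : Occ d S.N) : ℝ :=
  S.kinRest c + (S.kSq S.jstar + S.φ / S.N * c.1 0) * S.pairNum c

/-- The product states in the range of `Q i`. -/
def level (i : ℕ) : Set (Occ d S.N) :=
  {c | S.pairNum c + i = S.N ∨ S.pairNum c + (i + 1) = S.N}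

/-- The eigenvalues of `R i z`. -/
noncomputable def resolventDiag (i : ℕ) (z : ℝ) : Occ d S.N → ℝ :=
  (S.level i).indicator fun c => (S.diagEnergy c - z)⁻¹

variable {S} {i : ℕ} {z : ℝ} {c : Occ d S.N}

theorem hop_of_lt (h : c.1 0 < 2) : S.hop c = 0 := by
  rw [hop, pairAmpSq_of_lt h, Real.sqrt_zero, mul_zero]

theorem hop_sq (c : Occ d S.N) : S.hop c ^ 2 = (S.φ / S.N) ^ 2 * pairAmpSq S.jstar c := by
  rw [hop, mul_pow, Real.sq_sqrt (pairAmpSq_nonneg _ _)]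

theorem isWeightedComp_W (hj : S.jstar ≠ 0) :
    IsWeightedComp (occBasis d S.N) (occBasis d S.N) S.W S.hop (pairShift S.jstar) :=
  (isWeightedComp_pairOp hj S.N).smul (S.φ / S.N)

theorem isDiag_W_mul_mul_Wstar (hj : S.jstar ≠ 0) {G : S.Space →L[ℂ] S.Space}
    {g : Occ d S.N → ℝ} (hG : IsDiag (occBasis d S.N) G g) :
    IsDiag (occBasis d S.N) (S.W * G * S.Wstar)
      (fun c => S.hop c ^ 2 * g (pairShift S.jstar c)) :=
  (isWeightedComp_W hj).isDiag_comp_comp_adjoint (fun _ hc => hop_of_lt (not_le.1 hc))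
    (pairShift_injOn S.jstar) hG

theorem pairNum_pairShift (hj : S.jstar ≠ 0) (h : 2 ≤ c.1 0) :
    S.pairNum (pairShift S.jstar c) = S.pairNum c + 2 := by
  rw [pairNum, pairNum, pairShift_self hj h, pairShift_neg hj h]
  ring

theorem pairShift_mem_level (hj : S.jstar ≠ 0) (h : 2 ≤ c.1 0) :
    pairShift S.jstar c ∈ S.level i ↔ c ∈ S.level (i + 2) := by
  simp only [level, Set.mem_ofPred_eq, pairNum_pairShift hj h]
  grind

theorem notMem_level_add_two (hc : c ∈ S.level i) : c ∉ S.level (i + 2) := by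
  simp only [level, Set.mem_ofPred_eq] at hc ⊢
  omega

theorem isDiag_Q (i : ℕ) : IsDiag (occBasis d S.N) (S.Q i) ((S.level i).indicator 1) :=
  isDiag_proj _

theorem Q_apply_of_mem (f : S.Space) (hc : c ∈ S.level i) : S.Q i f c = f c :=
  Set.indicator_of_mem hc f

theorem Q_apply_of_notMem (f : S.Space) (hc : c ∉ S.level i) : S.Q i f c = 0 :=
  Set.indicator_of_notMem hc f

theorem Q_mul_W_mul_Q (hj : S.jstar ≠ 0) (i : ℕ) : S.Q i * S.W * S.Q i = 0 := by
  ext f c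
  change S.Q i (S.W (S.Q i f)) c = 0
  by_cases hc : c ∈ S.level i
  · rw [Q_apply_of_mem _ hc]
    refine (isWeightedComp_W hj (S.Q i f) c).trans ?_
    rcases lt_or_ge (c.1 0) 2 with h | h
    · simp only [hop_of_lt h, RCLike.ofReal_zero, zero_mul]
    · rw [occBasis_repr_apply, Q_apply_of_notMem, mul_zero]
      exact (pairShift_mem_level hj h).not.2 (notMem_level_add_two hc)
  · exact Q_apply_of_notMem _ hc

theorem Q_mul_Wstar_mul_Q (hj : S.jstar ≠ 0) (i : ℕ) : S.Q i * S.Wstar * S.Q i = 0 := by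
  have hQ : star (S.Q i) = S.Q i := (isDiag_Q i).isSymmetric.isSelfAdjoint
  have h := congrArg star (Q_mul_W_mul_Q hj i)
  rwa [star_mul, star_mul, hQ, star_zero, ← mul_assoc] at h

theorem hamHat_apply (f : S.Space) (c : Occ d S.N) :
    S.hamHat f c = (((S.kSq S.jstar + S.φ / S.N * c.1 0) * S.pairNum c : ℝ) : ℂ) * f c +
      S.W f c + S.Wstar f c := by
  have h_num (j : Mode d) (g : S.Space) : numOp j S.N g c = ((c.1 j : ℝ) : ℂ) * g c :=
    (isDiag_numOp j S.N).apply_occ g c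
  have h_mode (g : S.Space) :
      S.modeEnergy g c = ((S.kSq S.jstar + S.φ / S.N * c.1 0 : ℝ) : ℂ) * g c := by
    change ((S.kSq S.jstar : ℝ) : ℂ) * g c + ((S.φ / S.N : ℝ) : ℂ) * numOp 0 S.N g c = _
    rw [h_num]
    push_cast
    ring
  change S.modeEnergy (numOp S.jstar S.N f) c + S.modeEnergy (numOp (-S.jstar) S.N f) c +
    S.W f c + S.Wstar f c = _
  rw [h_mode, h_mode, h_num, h_num, pairNum]
  push_cast
  ring

theorem ham_apply (f : S.ham.domain) (c : Occ d S.N) :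
    S.ham f c = S.hamHat f.1 c + (S.kinRest c : ℂ) * f.1 c := rfl

theorem Q_ham_sub_smul_apply (hj : S.jstar ≠ 0) (f : S.ham.domain) (hf : S.Q i f = f) (z : ℝ)
    (c : Occ d S.N) :
    S.Q i (S.ham f - (z : ℂ) • (f : S.Space)) c = ((S.diagEnergy c - z : ℝ) : ℂ) * f.1 c := by
  by_cases hc : c ∈ S.level i
  · have h_apply {A : S.Space →L[ℂ] S.Space} (hA : S.Q i * A * S.Q i = 0) : A f.1 c = 0 := by
      have h : S.Q i (A (S.Q i f.1)) = 0 := DFunLike.congr_fun hA f.1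
      rw [← Q_apply_of_mem _ hc, ← hf, h]
      rfl
    rw [Q_apply_of_mem _ hc]
    change S.ham f c - (z : ℂ) * f.1 c = _
    rw [ham_apply, hamHat_apply, h_apply (Q_mul_W_mul_Q hj i), h_apply (Q_mul_Wstar_mul_Q hj i),
      diagEnergy]
    push_cast
    ring
  · rw [Q_apply_of_notMem _ hc, ← hf, Q_apply_of_notMem _ hc, mul_zero]

theorem IsResolvent.unique {H : S.Space →ₗ.[ℂ] S.Space} {P T T' : S.Space →L[ℂ] S.Space}
    (h : S.IsResolvent H P z T) (h' : S.IsResolvent H P z T') : T = T' := by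
  obtain ⟨hPT, -, h_right, -⟩ := h
  obtain ⟨-, hT'P, -, h_left'⟩ := h'
  ext1 f
  obtain ⟨h_dom, h_eq⟩ := h_right f
  calc T f = T' (P (H ⟨T f, h_dom⟩ - (z : ℂ) • T f)) :=
        (h_left' ⟨T f, h_dom⟩ (DFunLike.congr_fun hPT f)).symm
    _ = T' f := by rw [h_eq]; exact DFunLike.congr_fun hT'P f

theorem kSq_nonneg (j : Mode d) : 0 ≤ S.kSq j := Finset.sum_nonneg fun _ _ => sq_nonneg _

theorem kinRest_nonneg (c : Occ d S.N) : 0 ≤ S.kinRest c := by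
  refine Finset.sum_nonneg fun j _ => ?_
  dsimp only
  split_ifs
  · exact le_rfl
  · exact mul_nonneg (kSq_nonneg j) (Nat.cast_nonneg _)

theorem kinRest_le_diagEnergy (hφ : 0 ≤ S.φ) (c : Occ d S.N) : S.kinRest c ≤ S.diagEnergy c := by
  have := S.kSq_nonneg S.jstar
  exact le_add_of_nonneg_right (by positivity)

theorem diagEnergy_nonneg (hφ : 0 ≤ S.φ) (c : Occ d S.N) : 0 ≤ S.diagEnergy c :=
  (kinRest_nonneg c).trans (kinRest_le_diagEnergy hφ c)

theorem resolventDiag_nonneg (hφ : 0 ≤ S.φ) (hz : z < 0) (c : Occ d S.N) :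
    0 ≤ S.resolventDiag i z c :=
  Set.indicator_apply_nonneg fun _ =>
    inv_nonneg.2 (sub_nonneg.2 (hz.le.trans (diagEnergy_nonneg hφ c)))

theorem resolventDiag_le (hφ : 0 ≤ S.φ) (hz : z < 0) (c : Occ d S.N) :
    S.resolventDiag i z c ≤ (-z)⁻¹ := by
  refine Set.indicator_apply_le' (fun _ => inv_anti₀ (neg_pos.2 hz) ?_) fun _ => ?_
  · linarith [diagEnergy_nonneg hφ c]
  · exact inv_nonneg.2 (neg_nonneg.2 hz.le)

theorem sub_mul_resolventDiag (hφ : 0 ≤ S.φ) (hz : z < 0) (c : Occ d S.N) :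
    (S.diagEnergy c - z) * S.resolventDiag i z c = (S.level i).indicator 1 c := by
  by_cases hc : c ∈ S.level i
  · rw [resolventDiag, Set.indicator_of_mem hc, Set.indicator_of_mem hc, Pi.one_apply,
      mul_inv_cancel₀ (by linarith [diagEnergy_nonneg hφ c])]
  · rw [resolventDiag, Set.indicator_of_notMem hc, Set.indicator_of_notMem hc, mul_zero]

theorem kinRest_mul_resolventDiag_le_one (hφ : 0 ≤ S.φ) (hz : z < 0) (c : Occ d S.N) :
    S.kinRest c * S.resolventDiag i z c ≤ 1 :=
  calc S.kinRest c * S.resolventDiag i z c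
      ≤ (S.diagEnergy c - z) * S.resolventDiag i z c :=
        mul_le_mul_of_nonneg_right (by linarith [kinRest_le_diagEnergy hφ c])
          (resolventDiag_nonneg hφ hz c)
    _ ≤ 1 := by
        rw [sub_mul_resolventDiag hφ hz]
        exact Set.indicator_apply_le' (fun _ => le_rfl) fun _ => zero_le_one

theorem apply_mem_ham_domain (hφ : 0 ≤ S.φ) (hz : z < 0) {T : S.Space →L[ℂ] S.Space}
    (hT : IsDiag (occBasis d S.N) T (S.resolventDiag i z)) (f : S.Space) :
    T f ∈ S.ham.domain := by
  refine (lp.memℓp f.toLp).mono' fun c => ?_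
  have h_nonneg := mul_nonneg (kinRest_nonneg c) (resolventDiag_nonneg (i := i) hφ hz c)
  have h_apply : (S.kinRest c : ℂ) * T f c =
      ((S.kinRest c * S.resolventDiag i z c : ℝ) : ℂ) * f c := by
    rw [Complex.ofReal_mul, mul_assoc]
    exact congrArg _ (hT.apply_occ f c)
  rw [h_apply, norm_mul, Complex.norm_of_nonneg h_nonneg]
  exact mul_le_of_le_one_left (norm_nonneg _) (kinRest_mul_resolventDiag_le_one hφ hz c)

theorem isResolvent_of_isDiag (hφ : 0 ≤ S.φ) (hj : S.jstar ≠ 0) (hz : z < 0)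
    {T : S.Space →L[ℂ] S.Space} (hT : IsDiag (occBasis d S.N) T (S.resolventDiag i z)) :
    S.IsResolvent S.ham (S.Q i) z T := by
  have h_one_mul (c : Occ d S.N) :
      (S.level i).indicator 1 c * S.resolventDiag i z c = S.resolventDiag i z c := by
    by_cases hc : c ∈ S.level i <;> simp [resolventDiag, hc]
  have hQT : S.Q i ∘L T = T := (((isDiag_Q i).mul hT).congr h_one_mul).ext hT
  have hTQ : T ∘L S.Q i = T :=
    ((hT.mul (isDiag_Q i)).congr fun c => (mul_comm _ _).trans (h_one_mul c)).ext hT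
  refine ⟨hQT, hTQ, fun f => ⟨apply_mem_ham_domain hφ hz hT f, ?_⟩, fun f hf => ?_⟩
  · ext c
    rw [Q_ham_sub_smul_apply hj ⟨T f, _⟩ (DFunLike.congr_fun hQT f), hT.apply_occ,
      (isDiag_Q i).apply_occ, ← mul_assoc, ← Complex.ofReal_mul, sub_mul_resolventDiag hφ hz]
  · ext c
    conv_rhs => rw [← hf, (isDiag_Q i).apply_occ]
    rw [hT.apply_occ, Q_ham_sub_smul_apply hj f hf, ← mul_assoc, ← Complex.ofReal_mul,
      mul_comm (S.resolventDiag i z c), sub_mul_resolventDiag hφ hz]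

theorem R_eq_of_isResolvent {T : S.Space →L[ℂ] S.Space}
    (hT : S.IsResolvent S.ham (S.Q i) z T) : S.R i z = T := by
  have h : ∃ T, S.IsResolvent S.ham (S.Q i) z T := ⟨T, hT⟩
  rw [R, dif_pos h]
  exact h.choose_spec.unique hT

theorem isDiag_R_and_isResolvent_R (hφ : 0 ≤ S.φ) (hj : S.jstar ≠ 0) (i : ℕ) (hz : z < 0) :
    IsDiag (occBasis d S.N) (S.R i z) (S.resolventDiag i z) ∧
      S.IsResolvent S.ham (S.Q i) z (S.R i z) := by
  obtain ⟨T, hT, -⟩ := IsDiag.exists_of_bounded (occBasis d S.N) (S.resolventDiag i z)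
    (inv_nonneg.2 (neg_nonneg.2 hz.le)) fun c => by
      rw [abs_of_nonneg (resolventDiag_nonneg hφ hz c)]
      exact resolventDiag_le hφ hz c
  have h := isResolvent_of_isDiag hφ hj hz hT
  rw [R_eq_of_isResolvent h]
  exact ⟨hT, h⟩

end Hamiltonian

section Flow

variable {d : ℕ} (S : System d)

/-- The eigenvalues of `Γ z m` as a continued fraction: one step of the flow removes a pair of
particles from the condensate. Off the range of `Q (2 * m)`, where `Γ z m` vanishes, the
recursion is the same. -/
noncomputable def flow (z : ℝ) : ℕ → Occ d S.N → ℝ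
  | 0, _ => 0
  | m + 1, c => S.hop c ^ 2 /
      (S.diagEnergy (pairShift S.jstar c) - z - flow z m (pairShift S.jstar c))

/-- A supersolution of the recursion defining `flow`, uniform in the number of steps. -/
noncomputable def flowBound (c : Occ d S.N) : ℝ :=
  S.φ * (bogRatio S.eps * ((S.pairNum c : ℝ) / 2 + 1 + √S.eps) * ((c.1 0 : ℝ) / S.N))

/-- The eigenvalues of `R (2 * m) z * ∑' l, (Γ z m * R (2 * m) z) ^ l`. -/
noncomputable def dressedDiag (z : ℝ) (m : ℕ) : Occ d S.N → ℝ :=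
  (S.level (2 * m)).indicator fun c => (S.diagEnergy c - z - S.flow z m c)⁻¹

/-- The regime of weak coupling and low spectral parameter in which the flow is controlled. -/
structure Subcritical (z : ℝ) : Prop where
  φ_pos : 0 < S.φ
  jstar_ne : S.jstar ≠ 0
  eps_le : S.eps ≤ 1 / 100
  lt : z < -(S.φ * threshold S.eps)

variable {S} {z : ℝ} {m : ℕ} {c : Occ d S.N}

theorem flow_of_lt (hc : c.1 0 < 2) : S.flow z m c = 0 := by
  cases m with
  | zero => rfl
  | succ m => rw [flow, hop_of_lt hc, sq, zero_mul, zero_div]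

theorem hop_sq_mul_dressedDiag (hj : S.jstar ≠ 0) (z : ℝ) (m : ℕ) (c : Occ d S.N) :
    S.hop c ^ 2 * S.dressedDiag z m (pairShift S.jstar c) =
      (S.level (2 * (m + 1))).indicator (S.flow z (m + 1)) c := by
  rcases lt_or_ge (c.1 0) 2 with hc | hc
  · rw [hop_of_lt hc, Set.indicator_apply_eq_zero.2 fun _ => flow_of_lt hc, sq, zero_mul, zero_mul]
  · have h_iff := pairShift_mem_level (i := 2 * m) hj hc
    by_cases h_mem : c ∈ S.level (2 * (m + 1))
    · rw [dressedDiag, Set.indicator_of_mem (h_iff.2 h_mem), Set.indicator_of_mem h_mem, flow,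
        div_eq_mul_inv]
    · rw [dressedDiag, Set.indicator_of_notMem (mt h_iff.1 h_mem),
        Set.indicator_of_notMem h_mem, mul_zero]

theorem pairNum_add_le (hj : S.jstar ≠ 0) (c : Occ d S.N) : S.pairNum c + c.1 0 ≤ S.N := by
  have h_sum : ∑ i ∈ ({S.jstar, -S.jstar, 0} : Finset (Mode d)), c.1 i ≤ c.1.degree :=
    Finset.sum_le_sum_of_ne_zero fun i _ hi => Finsupp.mem_support_iff.2 hi
  rw [Finset.sum_insert (by simp [self_eq_neg, hj]), Finset.sum_insert (by simp [hj]),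
    Finset.sum_singleton, c.2, ← add_assoc] at h_sum
  exact h_sum

theorem hop_sq_le (hc : 1 ≤ c.1 0) :
    S.hop c ^ 2 ≤ (S.φ / S.N) ^ 2 *
      ((c.1 0 : ℝ) * ((c.1 0 : ℝ) - 1) * ((S.pairNum c : ℝ) / 2 + 1) ^ 2) := by
  have hc' : (0 : ℝ) ≤ (c.1 0 : ℝ) - 1 := sub_nonneg.2 (by exact_mod_cast hc)
  have h_amgm : ((c.1 S.jstar : ℝ) + 1) * ((c.1 (-S.jstar) : ℝ) + 1) ≤
      ((S.pairNum c : ℝ) / 2 + 1) ^ 2 := by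
    rw [pairNum, Nat.cast_add]
    linarith [sq_nonneg ((c.1 S.jstar : ℝ) - c.1 (-S.jstar))]
  rw [hop_sq, pairAmpSq]
  gcongr

theorem occ_zero_div_le_one (c : Occ d S.N) : (c.1 0 : ℝ) / S.N ≤ 1 :=
  div_le_one_of_le₀ (by exact_mod_cast occ_le 0 c) (Nat.cast_nonneg _)

theorem one_le_pairNum_of_mem_level (hm : 2 * m + 2 ≤ S.N) (hc : c ∈ S.level (2 * m)) :
    1 ≤ S.pairNum c := by
  simp only [level, Set.mem_ofPred_eq] at hc
  omega

theorem kSq_jstar_eq (hφ : S.φ ≠ 0) : S.kSq S.jstar = S.φ * S.eps := by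
  rw [eps, mul_div_cancel₀ _ hφ]

namespace Subcritical

theorem mono {z' : ℝ} (h : S.Subcritical z) (hz : z' ≤ z) : S.Subcritical z' :=
  { h with lt := hz.trans_lt h.lt }

theorem eps_nonneg (h : S.Subcritical z) : 0 ≤ S.eps := div_nonneg (kSq_nonneg _) h.φ_pos.le

theorem neg (h : S.Subcritical z) : z < 0 := by
  have := le_threshold h.eps_nonneg h.eps_le
  have := h.φ_pos
  exact h.lt.trans_le (neg_nonpos.2 (by positivity))

theorem sub_pos (h : S.Subcritical z) (c : Occ d S.N) : 0 < S.diagEnergy c - z :=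
  _root_.sub_pos.2 (h.neg.trans_le (diagEnergy_nonneg h.φ_pos.le c))

theorem le_diagEnergy_sub (h : S.Subcritical z) (c : Occ d S.N) :
    S.φ * ((S.eps + (c.1 0 : ℝ) / S.N) * S.pairNum c + threshold S.eps) ≤
      S.diagEnergy c - z := by
  rw [diagEnergy, kSq_jstar_eq h.φ_pos.ne']
  linear_combination kinRest_nonneg c + h.lt.le

theorem flowBound_nonneg (h : S.Subcritical z) (c : Occ d S.N) : 0 ≤ S.flowBound c := by
  have := h.φ_pos
  have := le_bogRatio h.eps_nonneg h.eps_le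
  unfold flowBound
  positivity

theorem flowBound_le (h : S.Subcritical z) (hc : 1 ≤ S.pairNum c) :
    S.flowBound c ≤ 9 / 10 * (S.diagEnergy c - z) :=
  calc S.flowBound c
      ≤ S.φ * (9 / 10 * ((S.eps + (c.1 0 : ℝ) / S.N) * S.pairNum c + threshold S.eps)) :=
        mul_le_mul_of_nonneg_left (bogRatio_mul_le_nine_tenths_mul h.eps_nonneg h.eps_le
          (by positivity) (occ_zero_div_le_one c) (by exact_mod_cast hc)) h.φ_pos.le
    _ ≤ 9 / 10 * (S.diagEnergy c - z) := by linarith [h.le_diagEnergy_sub c]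

theorem hop_sq_le_flowBound_mul (h : S.Subcritical z) (hc : 2 ≤ c.1 0) :
    S.hop c ^ 2 ≤ S.flowBound c *
      (S.diagEnergy (pairShift S.jstar c) - z - S.flowBound (pairShift S.jstar c)) := by
  have hu : (2 : ℝ) ≤ c.1 0 := by exact_mod_cast hc
  have hN : (0 : ℝ) < S.N := by exact_mod_cast (two_pos.trans_le hc).trans_le (occ_le 0 c)
  have h_total : (S.pairNum c : ℝ) + c.1 0 ≤ S.N := by exact_mod_cast pairNum_add_le h.jstar_ne c
  have h_super := mul_sq_le_bogRatio_mul h.eps_nonneg h.eps_le (s := ((c.1 0 : ℝ) - 2) / S.N)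
    (a := (S.pairNum c : ℝ) / 2 + 1) (w := 1 / S.N) (div_nonneg (by linarith) hN.le)
    (by linarith [Nat.cast_nonneg (α := ℝ) (S.pairNum c)]) (by positivity) (by
      field_simp
      linarith)
  have h_energy := h.le_diagEnergy_sub (pairShift S.jstar c)
  have h_bound : S.flowBound (pairShift S.jstar c) = S.φ * (bogRatio S.eps *
      ((S.pairNum c : ℝ) / 2 + 1 + 1 + √S.eps) * (((c.1 0 : ℝ) - 2) / S.N)) := by
    rw [flowBound, pairNum_pairShift h.jstar_ne hc, pairShift_zero h.jstar_ne hc,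
      Nat.cast_sub hc]
    push_cast
    ring
  rw [pairNum_pairShift h.jstar_ne hc, pairShift_zero h.jstar_ne hc, Nat.cast_sub hc] at h_energy
  push_cast at h_energy
  calc S.hop c ^ 2
      ≤ (S.φ / S.N) ^ 2 *
        ((c.1 0 : ℝ) * ((c.1 0 : ℝ) - 1) * ((S.pairNum c : ℝ) / 2 + 1) ^ 2) :=
        hop_sq_le (one_le_two.trans hc)
    _ = S.φ ^ 2 * ((c.1 0 : ℝ) / S.N) *
        ((((c.1 0 : ℝ) - 2) / S.N + 1 / S.N) * ((S.pairNum c : ℝ) / 2 + 1) ^ 2) := by ring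
    _ ≤ S.φ ^ 2 * ((c.1 0 : ℝ) / S.N) * _ :=
        mul_le_mul_of_nonneg_left h_super (by positivity)
    _ = S.flowBound c *
        (S.φ * ((S.eps + ((c.1 0 : ℝ) - 2) / S.N) * (S.pairNum c + 2) + threshold S.eps) -
          S.flowBound (pairShift S.jstar c)) := by
        rw [h_bound, flowBound]
        ring
    _ ≤ _ := by
        have := h.flowBound_nonneg c
        gcongr

theorem flow_nonneg_and_le_flowBound (h : S.Subcritical z) (m : ℕ) (c : Occ d S.N) :
    0 ≤ S.flow z m c ∧ S.flow z m c ≤ S.flowBound c := by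
  induction m generalizing c with
  | zero => exact ⟨le_rfl, h.flowBound_nonneg c⟩
  | succ m ih =>
    rcases lt_or_ge (c.1 0) 2 with hc | hc
    · rw [flow_of_lt hc]
      exact ⟨le_rfl, h.flowBound_nonneg c⟩
    have h_ih := (ih (pairShift S.jstar c)).2
    have h_gap := h.flowBound_le (c := pairShift S.jstar c)
      (by rw [pairNum_pairShift h.jstar_ne hc]; omega)
    have h_pos := h.sub_pos (pairShift S.jstar c)
    have h_den : 0 < S.diagEnergy (pairShift S.jstar c) - z -
        S.flow z m (pairShift S.jstar c) := by linarith
    rw [flow, div_le_iff₀ h_den]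
    refine ⟨by positivity, (h.hop_sq_le_flowBound_mul hc).trans ?_⟩
    have := h.flowBound_nonneg c
    gcongr

theorem flow_nonneg (h : S.Subcritical z) (m : ℕ) (c : Occ d S.N) : 0 ≤ S.flow z m c :=
  (h.flow_nonneg_and_le_flowBound m c).1

theorem flow_le (h : S.Subcritical z) (m : ℕ) (hc : 1 ≤ S.pairNum c) :
    S.flow z m c ≤ 9 / 10 * (S.diagEnergy c - z) :=
  (h.flow_nonneg_and_le_flowBound m c).2.trans (h.flowBound_le hc)

theorem sub_flow_pos (h : S.Subcritical z) (m : ℕ) (hc : 1 ≤ S.pairNum c) :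
    0 < S.diagEnergy c - z - S.flow z m c := by
  linarith [h.flow_le m hc, h.sub_pos c]

theorem abs_flow_mul_resolventDiag_le (h : S.Subcritical z) (hm : 2 * m + 2 ≤ S.N)
    (c : Occ d S.N) :
    |(S.level (2 * m)).indicator (S.flow z m) c * S.resolventDiag (2 * m) z c| ≤ 9 / 10 := by
  by_cases hc : c ∈ S.level (2 * m)
  · have := h.flow_nonneg m c
    have h_pos := h.sub_pos c
    rw [resolventDiag, Set.indicator_of_mem hc, Set.indicator_of_mem hc,
      abs_of_nonneg (by positivity), ← div_eq_mul_inv, div_le_iff₀ h_pos]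
    exact h.flow_le m (one_le_pairNum_of_mem_level hm hc)
  · rw [Set.indicator_of_notMem hc, zero_mul, abs_zero]
    norm_num

theorem resolventDiag_mul_inv_one_sub (h : S.Subcritical z) (m : ℕ) (c : Occ d S.N) :
    S.resolventDiag (2 * m) z c *
        (1 - (S.level (2 * m)).indicator (S.flow z m) c * S.resolventDiag (2 * m) z c)⁻¹ =
      S.dressedDiag z m c := by
  by_cases hc : c ∈ S.level (2 * m)
  · have h_pos := h.sub_pos c
    rw [resolventDiag, dressedDiag, Set.indicator_of_mem hc, Set.indicator_of_mem hc,
      Set.indicator_of_mem hc, ← mul_inv, mul_sub, mul_one, mul_left_comm,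
      mul_inv_cancel₀ h_pos.ne', mul_one]
  · simp [resolventDiag, dressedDiag, hc]

theorem isDiag_Γ (h : S.Subcritical z) (hm : 2 * m ≤ S.N) :
    IsDiag (occBasis d S.N) (S.Γ z m) ((S.level (2 * m)).indicator (S.flow z m)) := by
  induction m with
  | zero => exact fun f c => by simp [Γ, flow]
  | succ m ih =>
    have hR := (isDiag_R_and_isResolvent_R h.φ_pos.le h.jstar_ne (2 * m) h.neg).1
    have h_series := ((ih (by omega)).mul hR).tsum_pow (by norm_num) (by norm_num)
      (h.abs_flow_mul_resolventDiag_le hm)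
    have h_dressed := (hR.mul h_series).congr (h.resolventDiag_mul_inv_one_sub m)
    have h_step := isDiag_W_mul_mul_Wstar h.jstar_ne (((isDiag_Q (2 * m)).mul h_dressed).mul
      (isDiag_Q (2 * m)))
    have h_eq : S.Γ z (m + 1) = S.Q (2 * (m + 1)) *
        (S.W * (S.Q (2 * m) * (S.R (2 * m) z * ∑' l : ℕ, (S.Γ z m * S.R (2 * m) z) ^ l) *
          S.Q (2 * m)) * S.Wstar) * S.Q (2 * (m + 1)) := by
      simp only [Γ, mul_assoc]
    rw [h_eq]
    refine (((isDiag_Q _).mul h_step).mul (isDiag_Q _)).congr fun c => ?_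
    have h_Q (i : ℕ) (g : Occ d S.N → ℝ) (c : Occ d S.N) : (S.level i).indicator 1 c *
        (S.level i).indicator g c * (S.level i).indicator 1 c = (S.level i).indicator g c := by
      by_cases hc : c ∈ S.level i <;> simp [hc]
    simp only [dressedDiag, h_Q]
    rw [← dressedDiag, hop_sq_mul_dressedDiag h.jstar_ne, h_Q]

theorem isDiag_sqrtR (h : S.Subcritical z) (i : ℕ) :
    IsDiag (occBasis d S.N) (S.sqrtR i z) fun c => √(S.resolventDiag i z c) :=
  (isDiag_R_and_isResolvent_R h.φ_pos.le h.jstar_ne i h.neg).1.sqrt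
    (resolventDiag_nonneg h.φ_pos.le h.neg)

theorem isDiag_sqrtR_mul_mul_sqrtR (h : S.Subcritical z) {i : ℕ} {A : S.Space →L[ℂ] S.Space}
    {a : Occ d S.N → ℝ} (hA : IsDiag (occBasis d S.N) A a) :
    IsDiag (occBasis d S.N) (S.sqrtR i z * A * S.sqrtR i z) fun c =>
      a c * S.resolventDiag i z c := by
  refine (((h.isDiag_sqrtR i).mul hA).mul (h.isDiag_sqrtR i)).congr fun c => ?_
  rw [mul_right_comm, Real.mul_self_sqrt (resolventDiag_nonneg h.φ_pos.le h.neg c), mul_comm]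

theorem flowWellDefined (h : S.Subcritical z) : S.FlowWellDefined z := fun m hm => by
  obtain ⟨hR, h_resolvent⟩ := isDiag_R_and_isResolvent_R h.φ_pos.le h.jstar_ne (2 * m) h.neg
  have hΓ := h.isDiag_Γ (m := m) (by omega)
  have h_lt : (9 / 10 : ℝ) < 1 := by norm_num
  have h_contraction := h.abs_flow_mul_resolventDiag_le hm
  exact ⟨h_resolvent, hR.isPositive (resolventDiag_nonneg h.φ_pos.le h.neg),
    (hΓ.mul hR).summable_pow (by norm_num) h_lt h_contraction,
    (h.isDiag_sqrtR_mul_mul_sqrtR hΓ).summable_pow (by norm_num) h_lt h_contraction⟩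

theorem isDiag_effective (h : S.Subcritical z) (hm : 2 * m + 2 = S.N) :
    IsDiag (occBasis d S.N) (S.effective z) ((S.level S.N).indicator (S.flow z (m + 1))) := by
  have h_series := (h.isDiag_sqrtR_mul_mul_sqrtR (h.isDiag_Γ (m := m) (by omega))).tsum_pow
    (by norm_num) (by norm_num) (h.abs_flow_mul_resolventDiag_le hm.le)
  have h_dressed := (h.isDiag_sqrtR_mul_mul_sqrtR h_series).congr fun c =>
    (mul_comm _ _).trans (h.resolventDiag_mul_inv_one_sub m c)
  have h_sub : S.N - 2 = 2 * m := by omega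
  have h_div : (S.N - 2) / 2 = m := by omega
  have h_eq : S.effective z = S.W * (S.sqrtR (2 * m) z *
      (∑' l : ℕ, (S.sqrtR (2 * m) z * S.Γ z m * S.sqrtR (2 * m) z) ^ l) *
        S.sqrtR (2 * m) z) * S.Wstar := by
    rw [effective, Γcheck, h_div, h_sub]
    simp only [mul_assoc]
  have h_level : S.level S.N = S.level (2 * (m + 1)) := congrArg S.level hm.symm
  rw [h_eq, h_level]
  exact (isDiag_W_mul_mul_Wstar h.jstar_ne h_dressed).congr
    (hop_sq_mul_dressedDiag h.jstar_ne z m)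

end Subcritical

end Flow

section Comparison

variable {d : ℕ} (S : System d)

/-- The occupation numbers of the state `η`. -/
noncomputable def ηOcc : Occ d S.N := ⟨Finsupp.single 0 S.N, Finsupp.degree_single _ _⟩

/-- `c'` has the same particles in the modes `±jstar` as `c`, at least as many in the condensate,
and no more kinetic energy relative to the spectral parameters `z` and `z'`. -/
structure Dominates (z z' : ℝ) (c c' : Occ d S.N) : Prop where
  jstar_eq : c.1 S.jstar = c'.1 S.jstar
  neg_jstar_eq : c.1 (-S.jstar) = c'.1 (-S.jstar)
  zero_le : c.1 0 ≤ c'.1 0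
  kinRest_le : S.kinRest c' - z' ≤ S.kinRest c - z

variable {S} {z z' : ℝ} {c c' : Occ d S.N}

theorem isDiag_Pη : IsDiag (occBasis d S.N) S.Pη (({S.ηOcc} : Set (Occ d S.N)).indicator 1) := by
  have h_η : S.η = occBasis d S.N S.ηOcc := by
    classical
    rw [← (occBasis d S.N).repr_symm_single]
    change lp.single 2 _ _ = lp.single 2 _ _
    congr
  rw [Pη, h_η]
  exact .rankOne _ _

theorem isDiag_PηPerp : IsDiag (occBasis d S.N) S.PηPerp fun c =>
    ({c | S.pairNum c = 0} : Set (Occ d S.N)).indicator 1 c -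
      ({S.ηOcc} : Set (Occ d S.N)).indicator 1 c :=
  (isDiag_proj _).sub isDiag_Pη

theorem ηOcc_apply_of_ne {j : Mode d} (hj : j ≠ 0) : S.ηOcc.1 j = 0 :=
  Finsupp.single_eq_of_ne hj

theorem pairNum_ηOcc (hj : S.jstar ≠ 0) : S.pairNum S.ηOcc = 0 := by
  rw [pairNum, ηOcc_apply_of_ne hj, ηOcc_apply_of_ne (neg_ne_zero.2 hj)]

theorem eq_ηOcc (h : ∀ j ≠ 0, c.1 j = 0) : c = S.ηOcc := by
  have h_single : c.1 = Finsupp.single 0 (c.1 0) := by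
    ext j
    rcases eq_or_ne j 0 with rfl | hj
    · rw [Finsupp.single_eq_same]
    · rw [h j hj, Finsupp.single_eq_of_ne hj]
  have h_degree := c.2
  rw [h_single, Finsupp.degree_single] at h_degree
  exact Subtype.ext (h_single.trans (congrArg _ h_degree))

theorem kSq_zero : S.kSq 0 = 0 := by simp [kSq]

theorem kinRest_eq_of_forall_ne
    (h : ∀ j, j ≠ 0 → j ≠ S.jstar → j ≠ -S.jstar → c.1 j = c'.1 j) :
    S.kinRest c = S.kinRest c' := by
  classical
  unfold kinRest
  rw [Finsupp.sum_of_support_subset (s := c.1.support ∪ c'.1.support) _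
      Finset.subset_union_left _ (by simp),
    Finsupp.sum_of_support_subset (s := c.1.support ∪ c'.1.support) _
      Finset.subset_union_right _ (by simp)]
  refine Finset.sum_congr rfl fun j _ => ?_
  split_ifs with h_star
  · rfl
  · obtain ⟨h_jstar, h_neg⟩ := not_or.1 h_star
    rcases eq_or_ne j 0 with rfl | hj
    · rw [kSq_zero, zero_mul, zero_mul]
    · rw [h j hj h_jstar h_neg]

theorem kinRest_pairShift (hc : 2 ≤ c.1 0) : S.kinRest (pairShift S.jstar c) = S.kinRest c :=
  kinRest_eq_of_forall_ne fun _ h_zero h_jstar h_neg => pairShift_of_ne h_zero h_jstar h_neg hc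

theorem kinRest_ηOcc : S.kinRest S.ηOcc = 0 := by
  refine (Finsupp.sum_single_index ?_).trans ?_ <;> simp [kSq_zero]

theorem gap_nonneg : 0 ≤ S.gap :=
  Real.sInf_nonneg (by rintro _ ⟨j, -, rfl⟩; exact kSq_nonneg j)

theorem gap_le_kSq {j : Mode d} (hj : j ≠ 0) : S.gap ≤ S.kSq j :=
  csInf_le ⟨0, by rintro _ ⟨j, -, rfl⟩; exact kSq_nonneg j⟩ ⟨j, hj, rfl⟩

theorem kSq_mul_le_kinRest {j : Mode d} (h_jstar : j ≠ S.jstar) (h_neg : j ≠ -S.jstar)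
    (c : Occ d S.N) : S.kSq j * c.1 j ≤ S.kinRest c := by
  rcases eq_or_ne (c.1 j) 0 with hj | hj
  · rw [hj, Nat.cast_zero, mul_zero]
    exact kinRest_nonneg c
  · refine le_of_eq_of_le ?_ (Finset.single_le_sum (fun i _ => ?_) (Finsupp.mem_support_iff.2 hj))
    · exact (if_neg (not_or.2 ⟨h_jstar, h_neg⟩)).symm
    · have := S.kSq_nonneg i
      dsimp only
      split_ifs <;> positivity

theorem gap_le_kinRest (h_pair : S.pairNum c = 0) (hc : c ≠ S.ηOcc) : S.gap ≤ S.kinRest c := by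
  obtain ⟨j, hj, h_occ⟩ : ∃ j ≠ 0, c.1 j ≠ 0 := by
    contrapose! hc
    exact eq_ηOcc hc
  obtain ⟨h_jstar, h_neg⟩ := Nat.add_eq_zero_iff.1 h_pair
  calc S.gap ≤ S.kSq j := gap_le_kSq hj
    _ ≤ S.kSq j * c.1 j := le_mul_of_one_le_right (kSq_nonneg j)
        (by exact_mod_cast Nat.one_le_iff_ne_zero.2 h_occ)
    _ ≤ S.kinRest c := kSq_mul_le_kinRest (by rintro rfl; exact h_occ h_jstar)
        (by rintro rfl; exact h_occ h_neg) c

theorem dominates_ηOcc (hj : S.jstar ≠ 0) (h_pair : S.pairNum c = 0) (hc : c ≠ S.ηOcc) :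
    S.Dominates z (z - S.gap / 2) c S.ηOcc := by
  obtain ⟨h_jstar, h_neg⟩ := Nat.add_eq_zero_iff.1 h_pair
  refine ⟨?_, ?_, ?_, ?_⟩
  · rw [h_jstar, ηOcc_apply_of_ne hj]
  · rw [h_neg, ηOcc_apply_of_ne (neg_ne_zero.2 hj)]
  · exact (occ_le 0 c).trans_eq Finsupp.single_eq_same.symm
  · linarith [kinRest_ηOcc (S := S), gap_le_kinRest h_pair hc, S.gap_nonneg]

namespace Dominates

theorem pairNum_eq (h : S.Dominates z z' c c') : S.pairNum c = S.pairNum c' :=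
  congrArg₂ (· + ·) h.jstar_eq h.neg_jstar_eq

theorem pairShift (h : S.Dominates z z' c c') (hj : S.jstar ≠ 0) (hc : 2 ≤ c.1 0) :
    S.Dominates z z' (pairShift S.jstar c) (Bog.pairShift S.jstar c') := by
  have hc' := hc.trans h.zero_le
  refine ⟨?_, ?_, ?_, ?_⟩
  · rw [pairShift_self hj hc, pairShift_self hj hc', h.jstar_eq]
  · rw [pairShift_neg hj hc, pairShift_neg hj hc', h.neg_jstar_eq]
  · rw [pairShift_zero hj hc, pairShift_zero hj hc']
    exact Nat.sub_le_sub_right h.zero_le 2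
  · rw [kinRest_pairShift hc, kinRest_pairShift hc']
    exact h.kinRest_le

theorem zero_add_one_mul_diagEnergy_sub_le (h : S.Dominates z z' c c') (hz' : z' ≤ 0)
    (hN : S.φ / S.N ≤ S.kSq S.jstar) :
    ((c.1 0 : ℝ) + 1) * (S.diagEnergy c' - z') ≤ ((c'.1 0 : ℝ) + 1) * (S.diagEnergy c - z) := by
  have h_zero : (c.1 0 : ℝ) ≤ c'.1 0 := by exact_mod_cast h.zero_le
  have h_rest : ((c.1 0 : ℝ) + 1) * (S.kinRest c' - z') ≤
      ((c'.1 0 : ℝ) + 1) * (S.kinRest c - z) :=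
    mul_le_mul (by linarith) h.kinRest_le (by linarith [kinRest_nonneg c']) (by positivity)
  have h_pair := mul_le_mul_of_nonneg_right h_zero
    (mul_nonneg (sub_nonneg.2 hN) (S.pairNum c).cast_nonneg)
  rw [diagEnergy, diagEnergy, ← h.pairNum_eq]
  linarith

/-- The factors `c 0 + 1` make the induction go through: they compensate the interaction energy
`φ / N * c 0`, which grows with the condensate. -/
theorem flow_mul_zero_add_one_le (hz : S.Subcritical z) (hz' : S.Subcritical z')
    (hN : S.φ / S.N ≤ S.kSq S.jstar) (h : S.Dominates z z' c c') (m : ℕ) :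
    S.flow z m c * ((c'.1 0 : ℝ) + 1) ≤ S.flow z' m c' * ((c.1 0 : ℝ) + 1) := by
  induction m generalizing c c' with
  | zero => rw [flow, flow, zero_mul, zero_mul]
  | succ m ih =>
    rcases lt_or_ge (c.1 0) 2 with hc | hc
    · have := hz'.flow_nonneg (m + 1) c'
      rw [flow_of_lt hc, zero_mul]
      positivity
    have hc' := hc.trans h.zero_le
    have h_shift := h.pairShift hz.jstar_ne hc
    have h_flow := ih h_shift
    have h_energy := h_shift.zero_add_one_mul_diagEnergy_sub_le hz'.neg.le hN
    have h_pos := hz.sub_flow_pos m (c := Bog.pairShift S.jstar c)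
      (by rw [pairNum_pairShift hz.jstar_ne hc]; omega)
    have h_pos' := hz'.sub_flow_pos m (c := Bog.pairShift S.jstar c')
      (by rw [pairNum_pairShift hz.jstar_ne hc']; omega)
    rw [pairShift_zero hz.jstar_ne hc, pairShift_zero hz.jstar_ne hc', Nat.cast_sub hc,
      Nat.cast_sub hc'] at h_flow h_energy
    push_cast at h_flow h_energy
    have h_step := mul_sub_one_div_mul_le (u := c.1 0) (u' := c'.1 0)
      (by exact_mod_cast one_le_two.trans hc) (by exact_mod_cast h.zero_le) h_pos h_pos'
      (by linarith)
    rw [flow, flow, hop_sq, hop_sq, pairAmpSq, pairAmpSq, h.jstar_eq, h.neg_jstar_eq]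
    linear_combination (S.φ / S.N) ^ 2 *
      (((c'.1 S.jstar : ℝ) + 1) * ((c'.1 (-S.jstar) : ℝ) + 1)) * h_step

theorem flow_le (hz : S.Subcritical z) (hz' : S.Subcritical z')
    (hN : S.φ / S.N ≤ S.kSq S.jstar) (h : S.Dominates z z' c c') (m : ℕ) :
    S.flow z m c ≤ S.flow z' m c' := by
  have h_zero : (c.1 0 : ℝ) ≤ c'.1 0 := by exact_mod_cast h.zero_le
  have := hz'.flow_nonneg m c'
  refine le_of_mul_le_mul_right ((h.flow_mul_zero_add_one_le hz hz' hN m).trans ?_)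
    (by positivity : 0 < (c'.1 0 : ℝ) + 1)
  gcongr

end Dominates

theorem norm_PηPerp_mul_effective_mul_le (hz : S.Subcritical z)
    (hN : S.φ / S.N ≤ S.kSq S.jstar) (hm : 2 * m + 2 = S.N) :
    ‖S.PηPerp * S.effective z * S.PηPerp‖ ≤ ‖S.Pη * S.effective (z - S.gap / 2) * S.Pη‖ := by
  have hz' : S.Subcritical (z - S.gap / 2) := hz.mono (by linarith [S.gap_nonneg])
  have h_level (c : Occ d S.N) (hc : S.pairNum c = 0) : c ∈ S.level S.N :=
    Or.inl (by rw [hc, zero_add])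
  have h_η := ((isDiag_Pη.mul (hz'.isDiag_effective hm)).mul isDiag_Pη).abs_le_norm S.ηOcc
  have h_pair_η := pairNum_ηOcc hz.jstar_ne
  simp only [Set.indicator_of_mem (Set.mem_singleton _), Set.indicator_of_mem (h_level _ h_pair_η),
    Pi.one_apply, one_mul, mul_one] at h_η
  refine ((isDiag_PηPerp.mul (hz.isDiag_effective hm)).mul isDiag_PηPerp).norm_le
    (norm_nonneg _) fun c => ?_
  rcases eq_or_ne c S.ηOcc with rfl | hc
  · simp [h_pair_η]
  by_cases h_pair : S.pairNum c = 0
  · have h_le := (dominates_ηOcc (z := z) hz.jstar_ne h_pair hc).flow_le hz hz' hN (m + 1)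
    simpa [h_pair, hc, h_level c h_pair, abs_of_nonneg (hz.flow_nonneg (m + 1) c)] using
      (h_le.trans (le_abs_self _)).trans h_η
  · simp [h_pair, hc]

theorem energy_add_eq (hφ : 0 < S.φ) :
    S.energy + √S.eps * S.φ * √(S.eps ^ 2 + 2 * S.eps) = -(S.φ * threshold S.eps) := by
  have h_sq : (S.φ * S.eps) ^ 2 + 2 * S.φ * (S.φ * S.eps) =
      S.φ ^ 2 * (S.eps ^ 2 + 2 * S.eps) := by ring
  rw [energy, kSq_jstar_eq hφ.ne', h_sq, Real.sqrt_mul (sq_nonneg _), Real.sqrt_sq hφ.le, threshold,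
    bogRatio, excitation]
  ring

end Comparison

end System

end Bog

theorem mainTheorem8_general {d : ℕ} (S : Bog.System d) (hφ : 0 < S.φ) (hj : S.jstar ≠ 0)
    (hN : 0 < S.N) (hNe : Even S.N) (hε : S.eps ≤ 1 / 100) (hNε : 1 / (S.N : ℝ) ≤ S.eps)
    {z : ℝ} (hz : z < S.energy + √S.eps * S.φ * √(S.eps ^ 2 + 2 * S.eps)) :
    S.FlowWellDefined z ∧ S.FlowWellDefined (z - S.gap / 2) ∧
      ‖S.PηPerp * S.effective z * S.PηPerp‖ ≤
        ‖S.Pη * S.effective (z - S.gap / 2) * S.Pη‖ := by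
  have h_sub : S.Subcritical z := ⟨hφ, hj, hε, Bog.System.energy_add_eq hφ ▸ hz⟩
  have h_sub' : S.Subcritical (z - S.gap / 2) := h_sub.mono (by linarith [S.gap_nonneg])
  have h_kSq : S.φ / S.N ≤ S.kSq S.jstar := by
    rw [Bog.System.kSq_jstar_eq hφ.ne', div_eq_mul_one_div]
    gcongr
  obtain ⟨m, hm⟩ : ∃ m, 2 * m + 2 = S.N := by
    obtain ⟨k, hk⟩ := hNe
    exact ⟨k - 1, by omega⟩
  exact ⟨h_sub.flowWellDefined, h_sub'.flowWellDefined,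
    Bog.System.norm_PηPerp_mul_effective_mul_le h_sub h_kSq hm⟩

theorem mainTheorem8 (ν : ℝ) (hν : 11 / 8 < ν) (μ : ℝ) (hμ0 : 0 < μ) (hμ1 : μ < 1)
    (θ : ℝ) (hθ : 0 < θ) (K : ℝ) (hK : 0 < K) :
    ∃ ε₀ > (0 : ℝ), ∃ C > (0 : ℝ), ∃ c > (0 : ℝ),
      ∀ (d : ℕ) (S : Bog.System d), 0 < S.L → 0 < S.φ → S.jstar ≠ 0 → 0 < S.N → Even S.N →
        S.eps ≤ ε₀ →
        1 / (S.N : ℝ) ≤ S.eps ^ ν →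
        S.φ / S.gap * ((S.N : ℝ) ^ μ / ((S.N : ℝ) * ((S.N : ℝ) - (S.N : ℝ) ^ μ))) < 1 / 2 →
        1 / (S.N : ℝ) ^ μ ≤ K * Real.sqrt S.eps ^ (1 + θ) →
        ∀ z : ℝ,
          z < S.energy + Real.sqrt S.eps * S.φ * Real.sqrt (S.eps ^ 2 + 2 * S.eps) →
          S.FlowWellDefined z ∧ S.FlowWellDefined (z - S.gap / 2) ∧
          ‖S.PηPerp * S.effective z * S.PηPerp‖ ≤
            ‖S.Pη * S.effective (z - S.gap / 2) * S.Pη‖ +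
              C * (1 / Real.sqrt S.eps * (1 / (1 + c * Real.sqrt S.eps)) ^ ((S.N : ℝ) ^ μ)) := by
  refine ⟨1 / 100, by norm_num, 1, one_pos, 1, one_pos,
    fun d S _ hφ hj hN hNe hε hNε _ _ z hz => ?_⟩
  have h_eps : 0 ≤ S.eps := div_nonneg (Bog.System.kSq_nonneg _) hφ.le
  have h_pow : S.eps ^ ν ≤ S.eps :=
    Real.rpow_le_self_of_le_one h_eps (hε.trans (by norm_num)) (by linarith)
  obtain ⟨h_flow, h_flow', h_norm⟩ :=
    mainTheorem8_general S hφ hj hN hNe hε (hNε.trans h_pow) hz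
  exact ⟨h_flow, h_flow', h_norm.trans (le_add_of_nonneg_right (by positivity))⟩
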